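/- Let $h,k,l\ge 1$ be fixed integers. For $j\ge 0$ let $d_j(n)$ be the number of ordered $j$-tuples of positive integers with product $n$ (so $d_0(1)=1$ and $d_0(n)=0$ for $n>1$), and for $0<B\le 1$ put $d_l(n,B)=\sum_{q\mid n,\ q\le n^B}d_{l-1}(q)$ and $D_{h,k,l}(x)=\sum_{n\le x}d_k(n+h)d_l(n)$. Let $$C_{k,l}=\prod_p\Big((1-p^{-1})^{l-1}+(1-p^{-1})^{k-1}-(1-p^{-1})^{k+l-2}\Big)$$ and, where $p^{\gamma}$ denotes the exact power of $p$ dividing $h$, $$f_{k,l}(h)=\prod_{p\mid h}\frac{(1-p^{-1})\sum_{\alpha=0}^{\gamma}d_{l-1}(p^\alpha)\sum_{\beta=\alpha}^{\infty}d_k(p^\beta)p^{-\beta}+d_k(p^\gamma)\sum_{\alpha=\gamma+1}^{\infty}d_{l-1}(p^\alpha)p^{-\alpha}}{(1-p^{-1})^{1-k}+(1-p^{-1})^{1-l}-1}.$$ Let $\theta_k\in(0,1]$ be an exponent of distribution for $d_k$ for every $g\ge 1$; that is, for every $g\geq 1$ and $\varepsilon>0$ there are $\delta>0$ and $M$ such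 that for all real $x\ge 1$, all integers $1\le q\le x^{\theta_k-\varepsilon}$ and all residue classes $a\not\equiv 0\pmod q$ with $\gcd(a,q)=g$, $$\bigg|\sum_{\substack{n\le x\\ n\equiv a\,(\mathrm{mod}\,q)}}d_k(n)-\frac1{\varphi(q/g)}\sum_{\substack{m\le x/g\\ \gcd(m,q/g)=1}}d_k(gm)\bigg|\le M\,\frac{x^{1-\delta}}{\varphi(q/g)}.$$ Then the following three statements are equivalent: 1. $D_{h,k,l}(x)\sim\dfrac{C_{k,l}f_{k,l}(h)}{(k-1)!\,(l-1)!}\,x\log^{k+l-2}x$ as $x\to\infty$; 2. for some $B$ with $0<B<\theta_k$, $$\sum_{n\le x}d_k(n+h)\big(d_l(n)-B^{1-l}d_l(n,B)\big)=o\big(x\log^{k+l-2}x\big)\qquad(x\to\infty);$$ 3. the estimate in 2 holds for every $B$ with $0<B<\theta_k$. -/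

import Mathlib

open Filter Asymptotics
open scoped Topology

noncomputable section

/-- The `k`-fold divisor function: `divisorK k n` is the number of ordered `k`-tuples of positive
integers with product `n` (for `n ≥ 1`). In particular `divisorK 0 n` is `1` if `n = 1` and `0`
otherwise. -/
def divisorK (k n : ℕ) : ℕ :=
  (Nat.finMulAntidiag k n).card

/-- The partial divisor function `d_l(n, A) = ∑_{q ∣ n, q ≤ n ^ A} d_{l-1}(q)`, for `l ≥ 1`. -/
def partialDivisorK (l n : ℕ) (A : ℝ) : ℕ :=
  ∑ q ∈ n.divisors with ((q : ℕ) : ℝ) ≤ (n : ℝ) ^ A, divisorK (l - 1) q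

/-- The additive divisor sum `D_{h,k,l}(x) = ∑_{n ≤ x} d_k(n + h) d_l(n)`. -/
def additiveDivisorSum (h k l : ℕ) (x : ℝ) : ℝ :=
  ∑ n ∈ Finset.Icc 1 ⌊x⌋₊, (divisorK k (n + h) : ℝ) * (divisorK l n : ℝ)

/-- The constant `C_{k,l}`, an absolutely convergent product over all primes, for `k, l ≥ 1`. -/
def constC (k l : ℕ) : ℝ :=
  ∏' p : Nat.Primes,
    ((1 - ((p : ℕ) : ℝ)⁻¹) ^ (l - 1) + (1 - ((p : ℕ) : ℝ)⁻¹) ^ (k - 1)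
      - (1 - ((p : ℕ) : ℝ)⁻¹) ^ (k + l - 2))

/-- The numerator of the factor at the prime `p` of `f_{k,l}(h)`, where `γ` is the exponent of `p`
in `h`. The inner series over `β` runs over the exponents `α + β ≥ α`, the last one over the
exponents `γ + 1 + α ≥ γ + 1`. -/
def numeratorF (k l p γ : ℕ) : ℝ :=
  (1 - (p : ℝ)⁻¹) *
      ∑ α ∈ Finset.range (γ + 1), (divisorK (l - 1) (p ^ α) : ℝ) *
        ∑' β : ℕ, (divisorK k (p ^ (α + β)) : ℝ) * ((p : ℝ) ^ (α + β))⁻¹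
    + (divisorK k (p ^ γ) : ℝ) *
        ∑' α : ℕ, (divisorK (l - 1) (p ^ (γ + 1 + α)) : ℝ) * ((p : ℝ) ^ (γ + 1 + α))⁻¹

/-- The arithmetic factor `f_{k,l}(h)`, a product over the primes dividing `h`. -/
def factorF (k l h : ℕ) : ℝ :=
  ∏ p ∈ h.primeFactors,
    numeratorF k l p (h.factorization p) /
      ((1 - (p : ℝ)⁻¹) ^ (1 - (k : ℤ)) + (1 - (p : ℝ)⁻¹) ^ (1 - (l : ℤ)) - 1)

/-- The sum of `d_k(n)` over `n ≤ x` in the residue class of `a` modulo `q`. -/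
def divisorSumAP (k q a : ℕ) (x : ℝ) : ℝ :=
  ∑ n ∈ Finset.Icc 1 ⌊x⌋₊ with n ≡ a [MOD q], (divisorK k n : ℝ)

/-- The expected value of `divisorSumAP k q a x` when `gcd(a, q) = g`: the mean over the classes
`a` modulo `q` with `gcd(a, q) = g`, namely `φ(q/g)⁻¹ ∑_{m ≤ x/g, gcd(m, q/g) = 1} d_k(g m)`. -/
def divisorMeanAP (g k q : ℕ) (x : ℝ) : ℝ :=
  ((q / g).totient : ℝ)⁻¹ *
    ∑ m ∈ Finset.Icc 1 ⌊x / g⌋₊ with Nat.Coprime m (q / g), (divisorK k (g * m) : ℝ)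

/-- `θ ∈ (0, 1]` is an exponent of distribution for `d_k` with respect to the residue classes
`a` modulo `q` with `gcd(a, q) = g`: for each `ε > 0` there is a `δ > 0` such that `d_k` is
distributed uniformly, with error `O(x ^ (1 - δ) / φ(q/g))`, over these classes (other than the
zero class) for all `q ≤ x ^ (θ - ε)`. -/
def IsExponentOfDistribution (g k : ℕ) (θ : ℝ) : Prop :=
  0 < θ ∧ θ ≤ 1 ∧
    ∀ ε : ℝ, 0 < ε → ∃ δ : ℝ, 0 < δ ∧ ∃ M : ℝ, ∀ x : ℝ, 1 ≤ x → ∀ q : ℕ, 1 ≤ q →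
      (q : ℝ) ≤ x ^ (θ - ε) → ∀ a : ℕ, Nat.gcd a q = g → ¬ a ≡ 0 [MOD q] →
        |divisorSumAP k q a x - divisorMeanAP g k q x| ≤
          M * (x ^ (1 - δ) / ((q / g).totient : ℝ))

/-- The conjectured asymptotic
`D_{h,k,l}(x) ∼ C_{k,l} f_{k,l}(h) / ((k-1)! (l-1)!) * x * (log x) ^ (k+l-2)`. -/
def AdditiveDivisorAsymptotic (h k l : ℕ) : Prop :=
  additiveDivisorSum h k l ~[atTop] fun x : ℝ =>
    constC k l * factorF k l h / (((k - 1).factorial : ℝ) * ((l - 1).factorial : ℝ)) *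
      (x * Real.log x ^ (k + l - 2))

/-- The condition
`∑_{n ≤ x} d_k(n + h) (d_l(n) - B ^ (1-l) d_l(n, B)) = o(x (log x) ^ (k+l-2))`. -/
def PartialDivisorApproximation (h k l : ℕ) (B : ℝ) : Prop :=
  (fun x : ℝ => ∑ n ∈ Finset.Icc 1 ⌊x⌋₊, (divisorK k (n + h) : ℝ) *
      ((divisorK l n : ℝ) - B ^ (1 - (l : ℤ)) * (partialDivisorK l n B : ℝ)))
    =o[atTop] fun x : ℝ => x * Real.log x ^ (k + l - 2)

end

/-! The heart is an asymptotic that holds whether or not statement 1 does (`tendsto_partialSum`):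
for each `0 < B < θ`, the sum of `d_k(n+h) d_l(n,B)` over `n ≤ x` is asymptotic to `c B^(l-1) x
log^(k+l-2) x`, with `c` the constant of statement 1. Hence, for each single `B`, the sum in
statement 2 equals `D(x) - c x log^(k+l-2) x` up to `o(x log^(k+l-2) x)`. As `c ≠ 0`, statement 1 is
equivalent to the estimate for that `B`, and both equivalences follow.

For the asymptotic, freeze the cutoff at some `Q ≤ x^B`. Interchanging the sums leaves `d_k` summed
over the class of `h` modulo each `q ≤ Q`. The exponent of distribution replaces these sums by their
means with a power saving (`exists_abs_truncatedSum_sub_le`); the zero class, `q ∣ h`, needs no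
hypothesis. What remains is the sum over `n ≤ x + h`, `q ≤ Q` of `gcdWeight`, a multiplicative
function of two variables that behaves on average like `d_k(n) d_{l-1}(q)/q`. Dirichlet inversion in
each variable writes it as the convolution of `d_k ⊗ d_{l-1}/id` with a kernel `G`, whose local
factor at `p ∤ h` is `1 + O(p^(-2))`; hence `∑ |G(a,b)|/a` converges (`summable_abs_gcdKernel_div`).
Dominated convergence then yields the main term (`tendsto_sumGcdWeight`) with the constant `∑
G(a,b)/a`, whose Euler product is `C f` (`tsum_gcdKernel_div`). The factor `B^(l-1)` appears because
`∑_{q ≤ Q} d_{l-1}(q)/q ~ log^(l-1) Q/(l-1)!` and `log Q ~ B log x`.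

Finally, the moving cutoff `n^B` lies between `(ηx)^B` and `x^B` when `ηx < n ≤ x`, and the range `n
≤ ηx` contributes only a proportion `η`, which is arbitrarily small. -/

/-! ### Divisor sums and the recursion for `d_k` -/

open Finset in
lemma sum_divisorsAntidiagonal_mul_of_coprime {M : Type*} [AddCommMonoid M] {m n : ℕ}
    (hmn : m.Coprime n) (f : ℕ → ℕ → M) :
    ∑ x ∈ (m * n).divisorsAntidiagonal, f x.1 x.2 =
      ∑ x ∈ m.divisorsAntidiagonal, ∑ y ∈ n.divisorsAntidiagonal,
        f (x.1 * y.1) (x.2 * y.2) := by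
  rw [Nat.sum_divisorsAntidiagonal f,
    Nat.sum_divisorsAntidiagonal fun a b => ∑ y ∈ n.divisorsAntidiagonal, f (a * y.1) (b * y.2)]
  simp_rw [fun a b => Nat.sum_divisorsAntidiagonal (n := n) fun c d => f (a * c) (b * d)]
  rw [Nat.divisors_mul, Finset.mul_def, sum_image hmn.mul_injOn_divisors, sum_product]
  refine sum_congr rfl fun a ha => sum_congr rfl fun b hb => ?_
  rw [Nat.div_mul_div_comm (Nat.dvd_of_mem_divisors ha) (Nat.dvd_of_mem_divisors hb)]

open Finset in
lemma sum_divisorsAntidiagonal_prime_pow {M : Type*} [AddCommMonoid M] {p : ℕ} (hp : p.Prime)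
    (n : ℕ) (f : ℕ → ℕ → M) :
    ∑ x ∈ (p ^ n).divisorsAntidiagonal, f x.1 x.2 =
      ∑ x ∈ antidiagonal n, f (p ^ x.1) (p ^ x.2) := by
  rw [Nat.sum_divisorsAntidiagonal f, Nat.sum_divisors_prime_pow hp,
    Finset.Nat.sum_antidiagonal_eq_sum_range_succ (fun i j => f (p ^ i) (p ^ j))]
  refine sum_congr rfl fun i hi => ?_
  rw [Nat.pow_div (by simpa [Nat.lt_succ_iff] using hi) hp.pos]

lemma divisorK_zero (n : ℕ) : divisorK 0 n = if n = 1 then 1 else 0 := by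
  unfold divisorK
  split_ifs with h
  · rw [h, Nat.finMulAntidiag_one, Finset.card_singleton]
  · rw [Nat.finMulAntidiag_zero_left h, Finset.card_empty]

lemma divisorK_succ (k n : ℕ) :
    divisorK (k + 1) n = ∑ x ∈ n.divisorsAntidiagonal, divisorK k x.2 := by
  unfold divisorK
  rw [← Finset.card_sigma]
  refine Finset.card_bij' (fun f _ => ⟨(f 0, ∏ i, Fin.tail f i), Fin.tail f⟩)
    (fun y _ => Fin.cons y.1.1 y.2) ?_ ?_ ?_ ?_
  · intro f hf
    rw [Nat.mem_finMulAntidiag, Fin.prod_univ_succ] at hf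
    simp only [Finset.mem_sigma, Nat.mem_divisorsAntidiagonal, Nat.mem_finMulAntidiag]
    refine ⟨⟨hf.1, hf.2⟩, trivial, ?_⟩
    exact right_ne_zero_of_mul (hf.1 ▸ hf.2)
  · rintro ⟨⟨a, b⟩, f⟩ hy
    simp only [Finset.mem_sigma, Nat.mem_divisorsAntidiagonal, Nat.mem_finMulAntidiag] at hy
    rw [Nat.mem_finMulAntidiag, Fin.prod_univ_succ]
    refine ⟨?_, hy.1.2⟩
    simp [hy.2.1, hy.1.1]
  · intro f hf
    exact Fin.cons_self_tail f
  · rintro ⟨⟨a, b⟩, f⟩ hy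
    simp only [Finset.mem_sigma, Nat.mem_divisorsAntidiagonal, Nat.mem_finMulAntidiag] at hy
    obtain ⟨_, h, _⟩ := hy
    subst h
    simp [Fin.tail]

/-! ### Powers of `ζ` and `μ`, and their series at a prime -/

section

open ArithmeticFunction
open scoped ArithmeticFunction.zeta ArithmeticFunction.Moebius

/-- The `k`-fold divisor function as a real arithmetic function, the `k`-th power of `ζ`. -/
noncomputable def tau (k : ℕ) : ArithmeticFunction ℝ := (ζ : ArithmeticFunction ℝ) ^ k

/-- The Dirichlet inverse of `tau k`, the `k`-th power of `μ`. -/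
noncomputable def kappa (k : ℕ) : ArithmeticFunction ℝ := (μ : ArithmeticFunction ℝ) ^ k

/-- The quotient `f(n) / n`. -/
noncomputable def divId (f : ArithmeticFunction ℝ) : ArithmeticFunction ℝ := ⟨fun n => f n / n, by simp⟩

lemma divId_apply (f : ArithmeticFunction ℝ) (n : ℕ) : divId f n = f n / n := rfl

lemma divId_mul (f g : ArithmeticFunction ℝ) : divId (f * g) = divId f * divId g := by
  ext n
  simp only [divId_apply, mul_apply, Finset.sum_div]
  refine Finset.sum_congr rfl fun x hx => ?_
  rw [← (Nat.mem_divisorsAntidiagonal.1 hx).1]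
  push_cast
  exact mul_div_mul_comm _ _ _ _

lemma divId_one : divId 1 = 1 := by
  ext n
  rw [divId_apply, one_apply]
  split_ifs with h <;> simp [h]

lemma tau_zero : tau 0 = 1 := pow_zero _

lemma tau_succ (k : ℕ) : tau (k + 1) = ζ * tau k := pow_succ' _ _

lemma kappa_zero : kappa 0 = 1 := pow_zero _

lemma kappa_succ (k : ℕ) : kappa (k + 1) = μ * kappa k := pow_succ' _ _

lemma kappa_mul_tau (k : ℕ) : kappa k * tau k = 1 := by
  rw [kappa, tau, ← mul_pow, coe_moebius_mul_coe_zeta, one_pow]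

lemma tau_mul_kappa (k : ℕ) : tau k * kappa k = 1 := by
  rw [mul_comm, kappa_mul_tau]

lemma isMultiplicative_tau (k : ℕ) : (tau k).IsMultiplicative :=
  isMultiplicative_zeta.natCast.pow

lemma isMultiplicative_kappa (k : ℕ) : (kappa k).IsMultiplicative :=
  isMultiplicative_moebius.intCast.pow

lemma tau_apply (k n : ℕ) : tau k n = divisorK k n := by
  induction k generalizing n with
  | zero => rw [tau_zero, one_apply, divisorK_zero]; split_ifs <;> simp
  | succ k ih =>
    rw [tau_succ, mul_apply, divisorK_succ]
    push_cast
    refine Finset.sum_congr rfl fun x hx => ?_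
    rw [ih, natCoe_apply, zeta_apply_ne (Nat.left_ne_zero_of_mem_divisorsAntidiagonal hx)]
    simp

lemma tau_nonneg (k n : ℕ) : 0 ≤ tau k n := by rw [tau_apply]; positivity

lemma abs_mul_apply_le {f g f' g' : ArithmeticFunction ℝ} (hf : ∀ n, |f n| ≤ f' n)
    (hg : ∀ n, |g n| ≤ g' n) (n : ℕ) : |(f * g) n| ≤ (f' * g') n := by
  rw [mul_apply, mul_apply]
  refine (Finset.abs_sum_le_sum_abs _ _).trans (Finset.sum_le_sum fun x _ => ?_)
  rw [abs_mul]
  exact mul_le_mul (hf _) (hg _) (abs_nonneg _) ((abs_nonneg _).trans (hf _))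

lemma abs_kappa_le (k n : ℕ) : |kappa k n| ≤ tau k n := by
  induction k generalizing n with
  | zero => rw [kappa_zero, tau_zero, one_apply]; split_ifs <;> simp
  | succ k ih =>
    rw [kappa_succ, tau_succ]
    refine abs_mul_apply_le (fun m => ?_) ih n
    rcases eq_or_ne m 0 with rfl | hm
    · simp
    · rw [intCoe_apply, natCoe_apply, zeta_apply_ne hm]
      exact_mod_cast abs_moebius_le_one

lemma divId_tau_nonneg (k n : ℕ) : 0 ≤ divId (tau k) n :=
  div_nonneg (tau_nonneg _ _) n.cast_nonneg

lemma abs_divId_kappa_le (k n : ℕ) : |divId (kappa k) n| ≤ divId (tau k) n := by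
  rw [divId_apply, divId_apply, abs_div, Nat.abs_cast]
  gcongr
  exact abs_kappa_le k n

/-! ### Local series at a prime -/

lemma mul_apply_prime_pow (f g : ArithmeticFunction ℝ) {p : ℕ} (hp : p.Prime) (n : ℕ) :
    (f * g) (p ^ n) = ∑ x ∈ Finset.HasAntidiagonal.antidiagonal n, f (p ^ x.1) * g (p ^ x.2) := by
  rw [mul_apply, sum_divisorsAntidiagonal_prime_pow hp n fun a b => f a * g b]

/-- The series `∑ f(p^i) u^i` converges absolutely with sum `s`. -/
def LocalSum (f : ArithmeticFunction ℝ) (p : ℕ) (u s : ℝ) : Prop :=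
  (Summable fun i : ℕ => |f (p ^ i) * u ^ i|) ∧ ∑' i : ℕ, f (p ^ i) * u ^ i = s

lemma LocalSum.hasSum {f : ArithmeticFunction ℝ} {p : ℕ} {u s : ℝ} (hf : LocalSum f p u s) :
    HasSum (fun i : ℕ => f (p ^ i) * u ^ i) s :=
  hf.2 ▸ hf.1.of_abs.hasSum

/-- Along the powers of `p`, Dirichlet convolution is the Cauchy product of power series. -/
lemma LocalSum.mul {f g : ArithmeticFunction ℝ} {p : ℕ} (hp : p.Prime) {u s t : ℝ}
    (hf : LocalSum f p u s) (hg : LocalSum g p u t) : LocalSum (f * g) p u (s * t) := by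
  have key : ∀ n, (f * g) (p ^ n) * u ^ n = ∑ x ∈ Finset.HasAntidiagonal.antidiagonal n,
      (f (p ^ x.1) * u ^ x.1) * (g (p ^ x.2) * u ^ x.2) := by
    intro n
    rw [mul_apply_prime_pow f g hp, Finset.sum_mul]
    refine Finset.sum_congr rfl fun x hx => ?_
    rw [← Finset.HasAntidiagonal.mem_antidiagonal.1 hx]
    ring
  have hf' : Summable fun i : ℕ => ‖f (p ^ i) * u ^ i‖ := hf.1
  have hg' : Summable fun i : ℕ => ‖g (p ^ i) * u ^ i‖ := hg.1
  refine ⟨?_, ?_⟩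
  · have h := summable_norm_sum_mul_antidiagonal_of_summable_norm hf' hg'
    simp_rw [key]
    exact h
  · have h := tsum_mul_tsum_eq_tsum_sum_antidiagonal_of_summable_norm hf' hg'
    simp_rw [key]
    rw [← h, hf.2, hg.2]

lemma localSum_one {p : ℕ} (hp : p.Prime) (u : ℝ) : LocalSum 1 p u 1 := by
  have h : (fun i : ℕ => (1 : ArithmeticFunction ℝ) (p ^ i) * u ^ i) = Pi.single 0 1 := by
    ext i
    rcases eq_or_ne i 0 with rfl | hi
    · simp
    · rw [one_apply_ne (by simpa using ⟨hp.ne_one, hi⟩)]; simp [hi]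
  refine ⟨?_, ?_⟩
  · exact (h ▸ (hasSum_pi_single 0 (1 : ℝ)).summable :
      Summable fun i : ℕ => (1 : ArithmeticFunction ℝ) (p ^ i) * u ^ i).abs
  · rw [h]; exact (hasSum_pi_single 0 (1 : ℝ)).tsum_eq

lemma localSum_zeta {p : ℕ} (hp : p.Prime) {u : ℝ} (h0 : 0 ≤ u) (h1 : u < 1) :
    LocalSum (ζ : ArithmeticFunction ℝ) p u (1 - u)⁻¹ := by
  have h : (fun i : ℕ => (ζ : ArithmeticFunction ℝ) (p ^ i) * u ^ i) = fun i => u ^ i := by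
    ext i
    rw [natCoe_apply, zeta_apply_ne (pow_ne_zero _ hp.ne_zero)]; simp
  refine ⟨?_, ?_⟩
  · exact (h ▸ summable_geometric_of_lt_one h0 h1 :
      Summable fun i : ℕ => (ζ : ArithmeticFunction ℝ) (p ^ i) * u ^ i).abs
  · rw [h, tsum_geometric_of_lt_one h0 h1]

lemma localSum_moebius {p : ℕ} (hp : p.Prime) (u : ℝ) :
    LocalSum (μ : ArithmeticFunction ℝ) p u (1 - u) := by
  have h : ∀ i ∉ Finset.range 2, (μ : ArithmeticFunction ℝ) (p ^ i) * u ^ i = 0 := by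
    intro i hi
    rw [Finset.mem_range, not_lt] at hi
    rw [intCoe_apply, moebius_apply_prime_pow hp (by lia), if_neg (by lia)]
    simp
  have hs := hasSum_sum_of_ne_finset_zero (L := .unconditional ℕ) h
  refine ⟨hs.summable.abs, ?_⟩
  rw [hs.tsum_eq, Finset.sum_range_succ, Finset.sum_range_one]
  simp [moebius_apply_prime hp]
  ring

lemma localSum_tau {p : ℕ} (hp : p.Prime) {u : ℝ} (h0 : 0 ≤ u) (h1 : u < 1) (k : ℕ) :
    LocalSum (tau k) p u ((1 - u)⁻¹ ^ k) := by
  induction k with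
  | zero => simpa [tau_zero] using localSum_one hp u
  | succ k ih => rw [tau_succ, pow_succ']; exact (localSum_zeta hp h0 h1).mul hp ih

lemma localSum_kappa {p : ℕ} (hp : p.Prime) (u : ℝ) (k : ℕ) :
    LocalSum (kappa k) p u ((1 - u) ^ k) := by
  induction k with
  | zero => simpa [kappa_zero] using localSum_one hp u
  | succ k ih => rw [kappa_succ, pow_succ']; exact (localSum_moebius hp u).mul hp ih

/-- In the kernel's series, the first variable carries its weight in `u`, while the second has `1/q`
built into the function; hence the evaluation at `u = 1`. -/
lemma localSum_divId {f : ArithmeticFunction ℝ} {p : ℕ} {s : ℝ}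
    (hf : LocalSum f p (p : ℝ)⁻¹ s) : LocalSum (divId f) p 1 s := by
  have h : ∀ i : ℕ, divId f (p ^ i) * 1 ^ i = f (p ^ i) * (p : ℝ)⁻¹ ^ i := by
    intro i
    rw [divId_apply]
    push_cast
    rw [one_pow, mul_one, inv_pow, div_eq_mul_inv]
  exact ⟨by simp_rw [h]; exact hf.1, by simp_rw [h]; exact hf.2⟩

end

/-! ### Functions of two variables, the gcd weight and its kernel -/

section

open ArithmeticFunction

/-- The Dirichlet convolution of a function of two variables with `f` in the first and with `g` in
the second variable. -/
noncomputable def conv₂ (f g : ArithmeticFunction ℝ) (F : ℕ → ℕ → ℝ) (a b : ℕ) : ℝ :=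
  ∑ x ∈ a.divisorsAntidiagonal, f x.1 * ∑ y ∈ b.divisorsAntidiagonal, g y.1 * F x.2 y.2

lemma sum_mul_sum_of_mul_eq_one {f g : ArithmeticFunction ℝ} (h : f * g = 1) (F : ℕ → ℝ) {n : ℕ}
    (hn : n ≠ 0) :
    ∑ x ∈ n.divisorsAntidiagonal, f x.1 * ∑ y ∈ x.2.divisorsAntidiagonal, g y.1 * F y.2 = F n := by
  -- An arithmetic function must vanish at `0`; the change is harmless because only divisors of `n ≠
  -- 0` occur.
  let F' : ArithmeticFunction ℝ := ⟨fun m => if m = 0 then 0 else F m, by simp⟩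
  have hF' : ∀ m ≠ 0, F' m = F m := fun m hm => if_neg hm
  have key : (f * (g * F')) n = F' n := by rw [← mul_assoc, h, one_mul]
  rw [← hF' n hn, ← key, mul_apply]
  refine Finset.sum_congr rfl fun x _ => ?_
  rw [mul_apply]
  congr 1
  refine Finset.sum_congr rfl fun y hy => ?_
  rw [hF' _ (Nat.right_ne_zero_of_mem_divisorsAntidiagonal hy)]

/-- Inversion is done one variable at a time: the inner sum over `b` collapses first, then the sum
over `a`. -/
lemma conv₂_conv₂_of_mul_eq_one {f g f' g' : ArithmeticFunction ℝ} (hf : f * f' = 1)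
    (hg : g * g' = 1) (F : ℕ → ℕ → ℝ) {a b : ℕ} (ha : a ≠ 0) (hb : b ≠ 0) :
    conv₂ f g (conv₂ f' g' F) a b = F a b := by
  have h1 : ∀ c, ∑ y ∈ b.divisorsAntidiagonal, g y.1 * conv₂ f' g' F c y.2 =
      ∑ x ∈ c.divisorsAntidiagonal, f' x.1 * F x.2 b := by
    intro c
    simp_rw [conv₂, Finset.mul_sum]
    rw [Finset.sum_comm]
    refine Finset.sum_congr rfl fun x _ => ?_
    rw [← sum_mul_sum_of_mul_eq_one hg (F x.2) hb, Finset.mul_sum]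
    refine Finset.sum_congr rfl fun y _ => ?_
    rw [Finset.mul_sum, Finset.mul_sum]
    exact Finset.sum_congr rfl fun z _ => by ring
  rw [conv₂]
  simp_rw [h1]
  exact sum_mul_sum_of_mul_eq_one hf (fun m => F m b) ha

/-- Multiplicativity of a function of two variables. -/
def Multiplicative₂ (F : ℕ → ℕ → ℝ) : Prop :=
  F 1 1 = 1 ∧ ∀ a b a' b' : ℕ, (a * b).Coprime (a' * b') → F (a * a') (b * b') = F a b * F a' b'

lemma Multiplicative₂.conv₂ {f g : ArithmeticFunction ℝ} (hf : f.IsMultiplicative)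
    (hg : g.IsMultiplicative) {F : ℕ → ℕ → ℝ} (hF : Multiplicative₂ F) :
    Multiplicative₂ (conv₂ f g F) := by
  refine ⟨by simp [_root_.conv₂, hf.1, hg.1, hF.1], fun a b a' b' hc => ?_⟩
  have haa : a.Coprime a' := hc.coprime_mul_right.coprime_mul_right_right
  have hbb : b.Coprime b' := hc.coprime_mul_left.coprime_mul_left_right
  have expand : ∀ c d, _root_.conv₂ f g F c d = ∑ x ∈ c.divisorsAntidiagonal,
      ∑ y ∈ d.divisorsAntidiagonal, f x.1 * g y.1 * F x.2 y.2 := by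
    intro c d
    simp_rw [_root_.conv₂, Finset.mul_sum, mul_assoc]
  rw [expand, expand, expand, sum_divisorsAntidiagonal_mul_of_coprime haa
    fun c d => ∑ y ∈ (b * b').divisorsAntidiagonal, f c * g y.1 * F d y.2]
  simp_rw [fun c d => sum_divisorsAntidiagonal_mul_of_coprime hbb fun u v => f c * g u * F d v]
  rw [Finset.sum_mul]
  refine Finset.sum_congr rfl fun x hx => ?_
  rw [Finset.sum_comm, Finset.sum_mul]
  refine Finset.sum_congr rfl fun y hy => ?_
  rw [Finset.mul_sum]
  refine Finset.sum_congr rfl fun x' hx' => ?_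
  rw [Finset.mul_sum]
  refine Finset.sum_congr rfl fun y' hy' => ?_
  rw [Nat.mem_divisorsAntidiagonal] at hx hy hx' hy'
  rw [← hx.1, ← hy.1, ← hx'.1, ← hy'.1] at hc
  rw [← hx.1, ← hx'.1] at haa
  rw [← hy.1, ← hy'.1] at hbb
  rw [hf.2 haa.coprime_mul_right.coprime_mul_right_right,
    hg.2 hbb.coprime_mul_right.coprime_mul_right_right,
    hF.2 _ _ _ _ (hc.of_dvd (mul_dvd_mul (dvd_mul_left _ _) (dvd_mul_left _ _))
      (mul_dvd_mul (dvd_mul_left _ _) (dvd_mul_left _ _)))]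
  ring

lemma Multiplicative₂.abs {F : ℕ → ℕ → ℝ} (hF : Multiplicative₂ F) :
    Multiplicative₂ fun a b => |F a b| :=
  ⟨by simp [hF.1], fun a b a' b' h => by simp only [hF.2 a b a' b' h, abs_mul]⟩

/-- The sum of `G(a, b) / a` over the factorizations `m = a b`. -/
noncomputable def antidiagonalSum (G : ℕ → ℕ → ℝ) (m : ℕ) : ℝ :=
  ∑ x ∈ m.divisorsAntidiagonal, G x.1 x.2 / x.1

lemma antidiagonalSum_zero (G : ℕ → ℕ → ℝ) : antidiagonalSum G 0 = 0 := by
  simp [antidiagonalSum]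

lemma antidiagonalSum_one {G : ℕ → ℕ → ℝ} (hG : Multiplicative₂ G) : antidiagonalSum G 1 = 1 := by
  simp [antidiagonalSum, hG.1]

lemma antidiagonalSum_mul {G : ℕ → ℕ → ℝ} (hG : Multiplicative₂ G) {m n : ℕ} (h : m.Coprime n) :
    antidiagonalSum G (m * n) = antidiagonalSum G m * antidiagonalSum G n := by
  rw [antidiagonalSum, sum_divisorsAntidiagonal_mul_of_coprime h fun a b => G a b / a,
    antidiagonalSum, antidiagonalSum, Finset.sum_mul_sum]
  refine Finset.sum_congr rfl fun x hx => Finset.sum_congr rfl fun y hy => ?_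
  rw [Nat.mem_divisorsAntidiagonal] at hx hy
  rw [hG.2 _ _ _ _ (by rwa [hx.1, hy.1])]
  push_cast
  exact mul_div_mul_comm _ _ _ _

lemma antidiagonalSum_prime_pow (G : ℕ → ℕ → ℝ) {p : ℕ} (hp : p.Prime) (n : ℕ) :
    antidiagonalSum G (p ^ n) = ∑ x ∈ Finset.HasAntidiagonal.antidiagonal n,
      G (p ^ x.1) (p ^ x.2) * (p : ℝ)⁻¹ ^ x.1 := by
  rw [antidiagonalSum, sum_divisorsAntidiagonal_prime_pow hp n fun a b => G a b / a]
  refine Finset.sum_congr rfl fun x _ => ?_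
  push_cast
  rw [inv_pow, div_eq_mul_inv]

/-- The weight `d_k(n) d_j(q) / φ(q / (h, q))` on the pairs with `(n, q) = (h, q)`. -/
noncomputable def gcdWeight (h k j n q : ℕ) : ℝ :=
  tau k n * tau j q * if n.gcd q = h.gcd q then ((q / h.gcd q).totient : ℝ)⁻¹ else 0

lemma gcdWeight_nonneg (h k j n q : ℕ) : 0 ≤ gcdWeight h k j n q := by
  refine mul_nonneg (mul_nonneg (tau_nonneg _ _) (tau_nonneg _ _)) ?_
  split_ifs <;> positivity

/-- Both sides of the condition `(n, q) = (h, q)` factor over coprime blocks, so the condition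
splits into one for each block; note that `h` need not be factored for this. -/
lemma multiplicative₂_gcdWeight (h k j : ℕ) : Multiplicative₂ (gcdWeight h k j) := by
  refine ⟨by simp [gcdWeight, (isMultiplicative_tau _).1], fun n q n' q' hc => ?_⟩
  have hnn : n.Coprime n' := hc.coprime_mul_right.coprime_mul_right_right
  have hqq : q.Coprime q' := hc.coprime_mul_left.coprime_mul_left_right
  have hnq : n.Coprime q' := hc.coprime_mul_right.coprime_mul_left_right
  have hqn : n'.Coprime q := (hc.coprime_mul_left.coprime_mul_right_right).symm
  have h1 : (n * n').gcd (q * q') = n.gcd q * n'.gcd q' := by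
    rw [hqq.gcd_mul, Nat.Coprime.gcd_mul_right_cancel _ hqn,
      Nat.Coprime.gcd_mul_left_cancel _ hnq]
  have h2 : h.gcd (q * q') = h.gcd q * h.gcd q' := hqq.gcd_mul h
  -- A product of divisors of the coprime `q` and `q'` determines its factors: they are its gcds
  -- with `q` and `q'`.
  have hd : ∀ {a b : ℕ}, a ∣ q → b ∣ q' → (a * b).gcd q = a ∧ (a * b).gcd q' = b := by
    intro a b ha hb
    rw [Nat.Coprime.gcd_mul_right_cancel _ (hqq.symm.coprime_dvd_left hb),
      Nat.Coprime.gcd_mul_left_cancel _ (hqq.coprime_dvd_left ha)]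
    exact ⟨Nat.gcd_eq_left ha, Nat.gcd_eq_left hb⟩
  have h3 : (n * n').gcd (q * q') = h.gcd (q * q') ↔
      n.gcd q = h.gcd q ∧ n'.gcd q' = h.gcd q' := by
    rw [h1, h2]
    refine ⟨fun e => ?_, fun e => by rw [e.1, e.2]⟩
    have e1 := hd (n.gcd_dvd_right q) (n'.gcd_dvd_right q')
    have e2 := hd (h.gcd_dvd_right q) (h.gcd_dvd_right q')
    rw [e] at e1
    exact ⟨e1.1.symm.trans e2.1, e1.2.symm.trans e2.2⟩
  have h4 : ((q * q' / h.gcd (q * q')).totient : ℝ) =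
      (q / h.gcd q).totient * (q' / h.gcd q').totient := by
    rw [h2, ← Nat.div_mul_div_comm (h.gcd_dvd_right q) (h.gcd_dvd_right q'), Nat.totient_mul]
    · push_cast; rfl
    · exact hqq.of_dvd (Nat.div_dvd_of_dvd (h.gcd_dvd_right q))
        (Nat.div_dvd_of_dvd (h.gcd_dvd_right q'))
  unfold gcdWeight
  rw [(isMultiplicative_tau k).2 hnn, (isMultiplicative_tau j).2 hqq, h4, mul_inv]
  simp only [h3]
  by_cases c1 : n.gcd q = h.gcd q <;> by_cases c2 : n'.gcd q' = h.gcd q' <;>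
    simp only [c1, c2, and_true, and_false, if_true, if_false, mul_zero, zero_mul]
  ring

lemma isMultiplicative_divId {f : ArithmeticFunction ℝ} (hf : f.IsMultiplicative) :
    (divId f).IsMultiplicative := by
  refine ⟨by simp [divId_apply, hf.1], fun h => ?_⟩
  rw [divId_apply, hf.2 h, divId_apply, divId_apply]
  push_cast
  exact mul_div_mul_comm _ _ _ _

/-- The function `G` with `gcdWeight h k j = (d_k ⊗ d_j / id) * G`. -/
noncomputable def gcdKernel (h k j : ℕ) : ℕ → ℕ → ℝ :=
  conv₂ (kappa k) (divId (kappa j)) (gcdWeight h k j)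

lemma multiplicative₂_gcdKernel (h k j : ℕ) : Multiplicative₂ (gcdKernel h k j) :=
  (multiplicative₂_gcdWeight h k j).conv₂ (isMultiplicative_kappa k)
    (isMultiplicative_divId (isMultiplicative_kappa j))

lemma conv₂_gcdKernel (h k j : ℕ) {n q : ℕ} (hn : n ≠ 0) (hq : q ≠ 0) :
    conv₂ (tau k) (divId (tau j)) (gcdKernel h k j) n q = gcdWeight h k j n q :=
  conv₂_conv₂_of_mul_eq_one (tau_mul_kappa k)
    (by rw [← divId_mul, tau_mul_kappa, divId_one]) _ hn hq

lemma gcdKernel_zero_left (h k j b : ℕ) : gcdKernel h k j 0 b = 0 := by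
  simp [gcdKernel, conv₂]

lemma gcdKernel_zero_right (h k j a : ℕ) : gcdKernel h k j a 0 = 0 := by
  simp [gcdKernel, conv₂]

end

/-! ### Local factors of the kernel -/

section

open ArithmeticFunction Finset.HasAntidiagonal

/-- The Cauchy product in one variable, with an inert parameter from `B`. Used twice, with
coordinates swapped in between, it handles a convolution in both variables. -/
lemma hasSum_antidiagonal_mul {B : Type*} {f : ℕ → ℝ} {H : ℕ × B → ℝ} {s t : ℝ}
    (hf : HasSum f s) (hH : HasSum H t) :
    HasSum (fun z : ℕ × B => ∑ x ∈ antidiagonal z.1, f x.1 * H (x.2, z.2)) (s * t) := by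
  have h1 : HasSum (fun y : ℕ × (ℕ × B) => f y.1 * H y.2) (s * t) :=
    hf.mul hH (summable_mul_of_summable_norm hf.summable.norm hH.summable.norm)
  let e : (Σ z : ℕ × B, antidiagonal z.1) ≃ ℕ × (ℕ × B) :=
    { toFun := fun y => (y.2.1.1, (y.2.1.2, y.1.2))
      invFun := fun y => ⟨(y.1 + y.2.1, y.2.2), ⟨(y.1, y.2.1), mem_antidiagonal.2 rfl⟩⟩
      left_inv := by
        rintro ⟨⟨n, b⟩, ⟨⟨i, j⟩, h⟩⟩
        rw [mem_antidiagonal] at h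
        subst h
        rfl
      right_inv := fun _ => rfl }
  have h2 := (e.hasSum_iff.2 h1).sigma fun z => hasSum_fintype _
  refine h2.congr_fun ?_
  intro z
  exact (Finset.sum_coe_sort (antidiagonal z.1) fun x => f x.1 * H (x.2, z.2)).symm

lemma HasSum.antidiagonal {H : ℕ × ℕ → ℝ} {t : ℝ} (hH : HasSum H t) :
    HasSum (fun n : ℕ => ∑ x ∈ antidiagonal n, H x) t := by
  have h2 := (Finset.HasAntidiagonal.sigmaAntidiagonalEquivProd.hasSum_iff.2 hH).sigma
    fun z => hasSum_fintype _
  refine h2.congr_fun ?_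
  intro z
  exact (Finset.sum_coe_sort (Finset.HasAntidiagonal.antidiagonal z) H).symm

lemma hasSum_conv₂_prime_pow {f g : ArithmeticFunction ℝ} {p : ℕ} (hp : p.Prime) {u s t w : ℝ}
    (hf : LocalSum f p u s) (hg : LocalSum g p 1 t) {F : ℕ → ℕ → ℝ}
    (hF : HasSum (fun z : ℕ × ℕ => F (p ^ z.1) (p ^ z.2) * u ^ z.1) w) :
    HasSum (fun z : ℕ × ℕ => conv₂ f g F (p ^ z.1) (p ^ z.2) * u ^ z.1) (s * (t * w)) := by
  have h1 := hasSum_antidiagonal_mul hg.hasSum ((Equiv.prodComm ℕ ℕ).hasSum_iff.2 hF)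
  have h2 := hasSum_antidiagonal_mul hf.hasSum ((Equiv.prodComm ℕ ℕ).hasSum_iff.2 h1)
  refine h2.congr_fun ?_
  rintro ⟨a, b⟩
  simp only [conv₂]
  rw [sum_divisorsAntidiagonal_prime_pow hp a
    fun c d => f c * ∑ y ∈ (p ^ b).divisorsAntidiagonal, g y.1 * F d y.2, Finset.sum_mul]
  refine Finset.sum_congr rfl fun x hx => ?_
  rw [sum_divisorsAntidiagonal_prime_pow hp b fun c d => g c * F (p ^ x.2) d,
    ← mem_antidiagonal.1 hx, pow_add]
  simp only [Function.comp, Equiv.prodComm_apply, Prod.swap, Finset.mul_sum, Finset.sum_mul]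
  refine Finset.sum_congr rfl fun y _ => ?_
  ring

lemma conv₂_mul_prime_pow (f g v w : ArithmeticFunction ℝ) {p : ℕ} (hp : p.Prime) (a b : ℕ) :
    ∑ x ∈ antidiagonal a, f (p ^ x.1) * ∑ y ∈ antidiagonal b, g (p ^ y.1) *
      (v (p ^ x.2) * w (p ^ y.2)) = (f * v) (p ^ a) * (g * w) (p ^ b) := by
  rw [mul_apply_prime_pow f v hp, mul_apply_prime_pow g w hp, Finset.sum_mul]
  refine Finset.sum_congr rfl fun x _ => ?_
  rw [Finset.mul_sum, Finset.mul_sum]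
  exact Finset.sum_congr rfl fun y _ => by ring

/-- With `c` the exponent of `p` in `h`, the gcd condition reads `min a b = min c b`: it means `a ≥
b` when `b ≤ c`, and `a = c` when `b > c`. In the first case the totient is `φ(1) = 1`. -/
lemma gcdWeight_prime_pow {h : ℕ} (hh : h ≠ 0) (k j : ℕ) {p : ℕ} (hp : p.Prime) (a b : ℕ) :
    gcdWeight h k j (p ^ a) (p ^ b) =
      if b ≤ h.factorization p then
        if b ≤ a then tau k (p ^ a) * tau j (p ^ b) else 0
      else if a = h.factorization p then
        tau k (p ^ a) * tau j (p ^ b) *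
          ((p : ℝ) ^ (b - h.factorization p) * (1 - (p : ℝ)⁻¹))⁻¹
      else 0 := by
  set c := h.factorization p with hc
  have hpow : Function.Injective fun i : ℕ => p ^ i := Nat.pow_right_injective hp.two_le
  have h1 : ∀ a b : ℕ, (p ^ a).gcd (p ^ b) = p ^ min a b := by
    intro a b
    rcases le_total a b with hab | hab
    · rw [min_eq_left hab, Nat.gcd_eq_left (pow_dvd_pow p hab)]
    · rw [min_eq_right hab, Nat.gcd_eq_right (pow_dvd_pow p hab)]
  have h2 : h.gcd (p ^ b) = p ^ min c b := by
    rw [← h1]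
    conv_lhs => rw [← Nat.ordProj_mul_ordCompl_eq_self h p]
    rw [Nat.Coprime.gcd_mul_right_cancel]
    exact ((Nat.coprime_ordCompl hp hh).symm).pow_right b
  unfold gcdWeight
  have h3 : ∀ x y : ℕ, p ^ x = p ^ y ↔ x = y := fun x y => hpow.eq_iff
  simp only [h1, h2, h3]
  by_cases hb : b ≤ c
  · rw [if_pos hb, min_eq_right hb, Nat.div_self (pow_pos hp.pos b)]
    by_cases hba : b ≤ a
    · rw [if_pos hba, if_pos (min_eq_right hba)]; simp
    · rw [if_neg hba, if_neg (by lia), mul_zero]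
  · rw [if_neg hb, min_eq_left (by lia : c ≤ b), Nat.pow_div (by lia) hp.pos]
    by_cases hac : a = c
    · rw [if_pos hac, if_pos (by lia), Nat.totient_prime_pow hp (by lia)]
      congr 2
      obtain ⟨d, hd⟩ : ∃ d, b - c = d + 1 := ⟨b - c - 1, by lia⟩
      have hp0 : (p : ℝ) ≠ 0 := by exact_mod_cast hp.ne_zero
      rw [hd]
      push_cast [hp.one_le]
      field_simp
      ring
    · rw [if_neg hac, if_neg (by lia), mul_zero]

lemma Nat.Prime.inv_mem {p : ℕ} (hp : p.Prime) : 0 < (p : ℝ)⁻¹ ∧ (p : ℝ)⁻¹ ≤ 1 / 2 := by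
  have h2 : (2 : ℝ) ≤ p := by exact_mod_cast hp.two_le
  refine ⟨by positivity, ?_⟩
  rw [one_div]
  exact inv_anti₀ (by norm_num) h2

/-- The two parts of `numeratorF` are the two shapes of the support: the half-rows `a ≥ b` for `b ≤
c`, and the column `a = c` for `b > c`. The division by `1 - 1/p` comes from `φ(p^(b-c))` on the
column, where `p^(-c) p^(-(b-c)) = p^(-b)`. -/
lemma hasSum_gcdWeight_prime_pow {h : ℕ} (hh : h ≠ 0) (k l : ℕ) {p : ℕ} (hp : p.Prime) :
    HasSum (fun z : ℕ × ℕ => gcdWeight h k (l - 1) (p ^ z.1) (p ^ z.2) * (p : ℝ)⁻¹ ^ z.1)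
      (numeratorF k l p (h.factorization p) / (1 - (p : ℝ)⁻¹)) := by
  obtain ⟨hu0, hu1⟩ := hp.inv_mem
  have hp0 : (p : ℝ) ≠ 0 := by exact_mod_cast hp.ne_zero
  set c := h.factorization p with hc
  set j := l - 1 with hj
  have hs : ∀ (m d : ℕ), Summable fun i : ℕ =>
      (divisorK m (p ^ (d + i)) : ℝ) * ((p : ℝ) ^ (d + i))⁻¹ := by
    intro m d
    have h1 := (localSum_tau hp hu0.le (by linarith) m).hasSum.summable
    have h2 := h1.comp_injective (add_right_injective d)
    refine h2.congr fun i => ?_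
    simp [tau_apply]
  have piece1 : ∀ b ∈ Finset.range (c + 1), HasSum (fun z : ℕ × ℕ =>
      if z.2 = b ∧ b ≤ z.1 then tau k (p ^ z.1) * tau j (p ^ b) * (p : ℝ)⁻¹ ^ z.1 else 0)
      ((divisorK j (p ^ b) : ℝ) *
        ∑' i : ℕ, (divisorK k (p ^ (b + i)) : ℝ) * ((p : ℝ) ^ (b + i))⁻¹) := by
    intro b _
    have hi : Function.Injective fun i : ℕ => (b + i, b) := by
      intro x y hxy
      simpa using hxy
    rw [← hi.hasSum_iff]
    · refine ((hs k b).hasSum.mul_left _).congr_fun ?_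
      intro i
      simp [tau_apply]
      ring
    · rintro ⟨x, y⟩ hxy
      rw [if_neg]
      rintro ⟨h1, h2⟩
      exact hxy ⟨x - b, by simp only [Prod.mk.injEq]; simp only at h1 h2; lia⟩
  have piece2 : HasSum (fun z : ℕ × ℕ =>
      if c < z.2 ∧ z.1 = c then tau k (p ^ c) * tau j (p ^ z.2) *
        ((p : ℝ) ^ (z.2 - c) * (1 - (p : ℝ)⁻¹))⁻¹ * (p : ℝ)⁻¹ ^ c else 0)
      ((divisorK k (p ^ c) : ℝ) / (1 - (p : ℝ)⁻¹) *
        ∑' i : ℕ, (divisorK j (p ^ (c + 1 + i)) : ℝ) * ((p : ℝ) ^ (c + 1 + i))⁻¹) := by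
    have hi : Function.Injective fun i : ℕ => (c, c + 1 + i) := by
      intro x y hxy
      simpa using hxy
    rw [← hi.hasSum_iff]
    · refine ((hs j (c + 1)).hasSum.mul_left _).congr_fun ?_
      intro i
      have e1 : c + 1 + i - c = 1 + i := by lia
      have hlt : c < c + 1 + i := by lia
      simp only [Function.comp, tau_apply, e1, hlt, and_self, if_true]
      rw [mul_inv, inv_pow, add_assoc c 1 i, pow_add (p : ℝ) c]
      field_simp
    · rintro ⟨x, y⟩ hxy
      rw [if_neg]
      rintro ⟨h1, h2⟩
      exact hxy ⟨y - (c + 1), by simp only [Prod.mk.injEq]; simp only at h1 h2; lia⟩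
  have total := (hasSum_sum piece1).add piece2
  have hval : numeratorF k l p c / (1 - (p : ℝ)⁻¹) =
      ∑ b ∈ Finset.range (c + 1), (divisorK j (p ^ b) : ℝ) *
        ∑' i : ℕ, (divisorK k (p ^ (b + i)) : ℝ) * ((p : ℝ) ^ (b + i))⁻¹ +
      (divisorK k (p ^ c) : ℝ) / (1 - (p : ℝ)⁻¹) *
        ∑' i : ℕ, (divisorK j (p ^ (c + 1 + i)) : ℝ) * ((p : ℝ) ^ (c + 1 + i))⁻¹ := by
    have : (1 - (p : ℝ)⁻¹) ≠ 0 := by linarith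
    rw [numeratorF, add_div, mul_div_cancel_left₀ _ this, mul_div_right_comm]
  rw [hval]
  refine total.congr_fun ?_
  rintro ⟨a, b⟩
  rw [gcdWeight_prime_pow hh k j hp, ← hc]
  simp only
  by_cases hb : b ≤ c
  · rw [if_pos hb, if_neg (by lia : ¬ (c < b ∧ a = c)), add_zero, Finset.sum_eq_single b]
    · by_cases hba : b ≤ a <;> simp [hba]
    · intro d _ hd
      rw [if_neg (by lia)]
    · intro hb'
      exact absurd (Finset.mem_range.2 (by lia)) hb'
  · rw [if_neg hb, Finset.sum_eq_zero, zero_add]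
    · by_cases hac : a = c
      · rw [if_pos hac, if_pos (⟨by lia, hac⟩ : c < b ∧ a = c), hac]
      · rw [if_neg hac, if_neg (by lia : ¬ (c < b ∧ a = c)), zero_mul]
    · intro d hd
      rw [Finset.mem_range] at hd
      rw [if_neg (by lia)]

lemma hasSum_gcdKernel_prime_pow {h : ℕ} (hh : h ≠ 0) (k l : ℕ) {p : ℕ} (hp : p.Prime) :
    HasSum (fun z : ℕ × ℕ => gcdKernel h k (l - 1) (p ^ z.1) (p ^ z.2) * (p : ℝ)⁻¹ ^ z.1)
      ((1 - (p : ℝ)⁻¹) ^ k * ((1 - (p : ℝ)⁻¹) ^ (l - 1) *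
        (numeratorF k l p (h.factorization p) / (1 - (p : ℝ)⁻¹)))) :=
  hasSum_conv₂_prime_pow hp (localSum_kappa hp _ k) (localSum_divId (localSum_kappa hp _ _))
    (hasSum_gcdWeight_prime_pow hh k l hp)

/-- For `p ∤ h` the support of the weight is the union of the two axes, so the weight is a
combination of three pure tensors. Each factor is then convolved separately, where `κ_k * τ_k = 1`
makes most of it collapse. -/
lemma gcdKernel_prime_pow_of_not_dvd {h : ℕ} (hh : h ≠ 0) (k j : ℕ) {p : ℕ} (hp : p.Prime)
    (hph : ¬ p ∣ h) (a b : ℕ) :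
    gcdKernel h k j (p ^ a) (p ^ b) =
      (1 : ArithmeticFunction ℝ) (p ^ a) * divId (kappa j) (p ^ b) +
        (1 - (p : ℝ)⁻¹)⁻¹ * (kappa k (p ^ a) *
          ((1 : ArithmeticFunction ℝ) (p ^ b) - divId (kappa j) (p ^ b))) := by
  have hc : h.factorization p = 0 := Nat.factorization_eq_zero_of_not_dvd hph
  have h1 : ∀ i : ℕ, (1 : ArithmeticFunction ℝ) (p ^ i) = if i = 0 then 1 else 0 := by
    intro i
    rw [one_apply]
    simp [hp.ne_one]
  have hF : ∀ x y : ℕ, gcdWeight h k j (p ^ x) (p ^ y) =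
      tau k (p ^ x) * (1 : ArithmeticFunction ℝ) (p ^ y) + (1 - (p : ℝ)⁻¹)⁻¹ *
        ((1 : ArithmeticFunction ℝ) (p ^ x) * divId (tau j) (p ^ y) -
          (1 : ArithmeticFunction ℝ) (p ^ x) * (1 : ArithmeticFunction ℝ) (p ^ y)) := by
    intro x y
    rw [gcdWeight_prime_pow hh k j hp, hc, h1, h1, divId_apply]
    rcases eq_or_ne y 0 with rfl | hy
    · simp [(isMultiplicative_tau _).1]
    · rcases eq_or_ne x 0 with rfl | hx
      · simp [hy, (isMultiplicative_tau _).1]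
        ring
      · simp [hx, hy]
  rw [gcdKernel, conv₂, sum_divisorsAntidiagonal_prime_pow hp a fun c d => kappa k c *
    ∑ y ∈ (p ^ b).divisorsAntidiagonal, divId (kappa j) y.1 * gcdWeight h k j d y.2]
  simp_rw [fun d => sum_divisorsAntidiagonal_prime_pow hp b fun u v =>
    divId (kappa j) u * gcdWeight h k j d v, hF]
  have e : ∀ x : ℕ × ℕ, kappa k (p ^ x.1) * ∑ y ∈ antidiagonal b, divId (kappa j) (p ^ y.1) *
      (tau k (p ^ x.2) * (1 : ArithmeticFunction ℝ) (p ^ y.2) + (1 - (p : ℝ)⁻¹)⁻¹ *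
        ((1 : ArithmeticFunction ℝ) (p ^ x.2) * divId (tau j) (p ^ y.2) -
          (1 : ArithmeticFunction ℝ) (p ^ x.2) * (1 : ArithmeticFunction ℝ) (p ^ y.2))) =
      kappa k (p ^ x.1) * ∑ y ∈ antidiagonal b, divId (kappa j) (p ^ y.1) *
        (tau k (p ^ x.2) * (1 : ArithmeticFunction ℝ) (p ^ y.2)) + (1 - (p : ℝ)⁻¹)⁻¹ *
      (kappa k (p ^ x.1) * ∑ y ∈ antidiagonal b, divId (kappa j) (p ^ y.1) *
        ((1 : ArithmeticFunction ℝ) (p ^ x.2) * divId (tau j) (p ^ y.2)) -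
      kappa k (p ^ x.1) * ∑ y ∈ antidiagonal b, divId (kappa j) (p ^ y.1) *
        ((1 : ArithmeticFunction ℝ) (p ^ x.2) * (1 : ArithmeticFunction ℝ) (p ^ y.2))) := by
    intro x
    have e' : ∀ y : ℕ × ℕ, divId (kappa j) (p ^ y.1) *
        (tau k (p ^ x.2) * (1 : ArithmeticFunction ℝ) (p ^ y.2) + (1 - (p : ℝ)⁻¹)⁻¹ *
          ((1 : ArithmeticFunction ℝ) (p ^ x.2) * divId (tau j) (p ^ y.2) -
            (1 : ArithmeticFunction ℝ) (p ^ x.2) * (1 : ArithmeticFunction ℝ) (p ^ y.2))) =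
        divId (kappa j) (p ^ y.1) *
          (tau k (p ^ x.2) * (1 : ArithmeticFunction ℝ) (p ^ y.2)) + (1 - (p : ℝ)⁻¹)⁻¹ *
        (divId (kappa j) (p ^ y.1) *
          ((1 : ArithmeticFunction ℝ) (p ^ x.2) * divId (tau j) (p ^ y.2)) -
        divId (kappa j) (p ^ y.1) *
          ((1 : ArithmeticFunction ℝ) (p ^ x.2) * (1 : ArithmeticFunction ℝ) (p ^ y.2))) :=
      fun y => by ring
    simp_rw [e']
    rw [Finset.sum_add_distrib, ← Finset.mul_sum, Finset.sum_sub_distrib]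
    ring
  simp_rw [e]
  rw [Finset.sum_add_distrib, ← Finset.mul_sum, Finset.sum_sub_distrib,
    conv₂_mul_prime_pow _ _ _ _ hp, conv₂_mul_prime_pow _ _ _ _ hp, conv₂_mul_prime_pow _ _ _ _ hp,
    kappa_mul_tau, mul_one, mul_one, ← divId_mul, kappa_mul_tau, divId_one]
  ring

lemma inv_one_sub_pow_sub_one_le {u : ℝ} (h0 : 0 ≤ u) (h1 : u ≤ 1 / 2) (k : ℕ) :
    (1 - u)⁻¹ ^ k - 1 ≤ k * 2 ^ k * u := by
  have hb : 1 - k * u ≤ (1 - u) ^ k := by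
    have := one_add_mul_le_pow (a := -u) (by linarith) k
    rw [← sub_eq_add_neg] at this
    linarith
  have hpos : 0 < 1 - u := by linarith
  have h2 : (1 - u)⁻¹ ≤ 2 := by
    rw [inv_le_comm₀ hpos (by norm_num)]; linarith
  have h3 : (1 - u)⁻¹ ^ k ≤ 2 ^ k := by gcongr
  have h4 : (1 - u)⁻¹ ^ k * (1 - u) ^ k = 1 := by
    rw [← mul_pow, inv_mul_cancel₀ hpos.ne', one_pow]
  calc (1 - u)⁻¹ ^ k - 1 = (1 - u)⁻¹ ^ k * (1 - (1 - u) ^ k) := by rw [mul_sub, h4, mul_one]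
    _ ≤ (1 - u)⁻¹ ^ k * (k * u) := by gcongr; linarith
    _ ≤ 2 ^ k * (k * u) := by gcongr
    _ = k * 2 ^ k * u := by ring

/-- The source of absolute convergence: the kernel has no terms of order `1/p`. It vanishes for `b =
0 < a`. For `a = 0 < b` the coefficient `1 - (1-u)⁻¹` supplies a factor `u` besides the `1/p^b`, and
for `a, b > 0` both variables contribute a factor `u`. -/
lemma tsum_abs_gcdKernel_prime_pow_le {h : ℕ} (hh : h ≠ 0) (k j : ℕ) {p : ℕ} (hp : p.Prime)
    (hph : ¬ p ∣ h) :
    ∑' z : ℕ × ℕ, |gcdKernel h k j (p ^ z.1) (p ^ z.2)| * (p : ℝ)⁻¹ ^ z.1 ≤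
      1 + 2 * (j * 2 ^ j) * (1 + k * 2 ^ k) * ((p : ℝ)⁻¹) ^ 2 := by
  obtain ⟨hu0, hu1⟩ := hp.inv_mem
  set u := (p : ℝ)⁻¹ with hu
  have h1 : ∀ i : ℕ, (1 : ArithmeticFunction ℝ) (p ^ i) = if i = 0 then 1 else 0 := by
    intro i
    rw [one_apply]
    simp [hp.ne_one]
  let δ : ℕ → ℝ := fun i => if i = 0 then 1 else 0
  have hδ : HasSum δ 1 := hasSum_ite_eq 0 1
  let A : ℕ → ℝ := fun i => tau k (p ^ i) * u ^ i - δ i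
  let B : ℕ → ℝ := fun i => divId (tau j) (p ^ i) * 1 ^ i - δ i
  have hA : HasSum A ((1 - u)⁻¹ ^ k - 1) := (localSum_tau hp hu0.le (by linarith) k).hasSum.sub hδ
  have hB : HasSum B ((1 - u)⁻¹ ^ j - 1) :=
    (localSum_divId (localSum_tau hp hu0.le (by linarith) j)).hasSum.sub hδ
  have hA0 : A 0 = 0 := by simp [A, δ, (isMultiplicative_tau k).1]
  have hB0 : B 0 = 0 := by simp [B, δ, divId_apply, (isMultiplicative_tau j).1]
  have hAn : ∀ i, i ≠ 0 → A i = tau k (p ^ i) * u ^ i := fun i hi => by simp [A, δ, hi]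
  have hBn : ∀ i, i ≠ 0 → B i = divId (tau j) (p ^ i) := fun i hi => by simp [B, δ, hi]
  -- The majorant off the origin is `2 (u δ + A)(a) B(b)`: `u δ` serves the column `a = 0`, `A` the
  -- terms with `a > 0`, and `2` bounds `(1-u)⁻¹`.
  have hC : HasSum (fun i => u * δ i + A i) (u * 1 + ((1 - u)⁻¹ ^ k - 1)) := (hδ.mul_left u).add hA
  have hCB := hC.mul hB (summable_mul_of_summable_norm hC.summable.norm hB.summable.norm)
  have hδδ := hδ.mul hδ (summable_mul_of_summable_norm hδ.summable.norm hδ.summable.norm)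
  have hbound := hδδ.add (hCB.mul_left 2)
  have hle : ∀ z : ℕ × ℕ, |gcdKernel h k j (p ^ z.1) (p ^ z.2)| * u ^ z.1 ≤
      δ z.1 * δ z.2 + 2 * ((u * δ z.1 + A z.1) * B z.2) := by
    rintro ⟨a, b⟩
    simp only
    have hinv : (1 - u)⁻¹ ≤ 2 := by
      rw [inv_le_comm₀ (by linarith) (by norm_num)]; linarith
    have hinv0 : 0 < (1 - u)⁻¹ := inv_pos.2 (by linarith)
    rw [gcdKernel_prime_pow_of_not_dvd hh k j hp hph, ← hu, h1, h1]
    rcases eq_or_ne b 0 with rfl | hb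
    · rcases eq_or_ne a 0 with rfl | ha
      · simp [hB0, δ, divId_apply, (isMultiplicative_kappa j).1]
      · simp [hB0, δ, ha, divId_apply, (isMultiplicative_kappa j).1]
    · rw [hBn b hb]
      have hκ := abs_divId_kappa_le j (p ^ b)
      have hτ := divId_tau_nonneg j (p ^ b)
      rcases eq_or_ne a 0 with rfl | ha
      · have e : (1 : ℝ) * divId (kappa j) (p ^ b) + (1 - u)⁻¹ * (1 * (0 - divId (kappa j) (p ^ b)))
            = -((1 - u)⁻¹ * u) * divId (kappa j) (p ^ b) := by
          have : (1 - u) ≠ 0 := by linarith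
          field_simp
          ring
        simp only [pow_zero, (isMultiplicative_kappa k).1, if_true, if_neg hb, hA0, δ, mul_one,
          mul_zero, zero_add, add_zero]
        simp only [one_mul] at e ⊢
        rw [e, abs_mul, abs_neg, abs_of_nonneg (by positivity)]
        calc (1 - u)⁻¹ * u * |divId (kappa j) (p ^ b)| ≤ 2 * u * divId (tau j) (p ^ b) := by gcongr
          _ = _ := by ring
      · simp only [if_neg ha, if_neg hb, hAn a ha, δ, mul_zero, zero_mul, zero_add, zero_sub]
        rw [abs_mul, abs_mul, abs_neg, abs_of_pos hinv0]
        have hκ' := abs_kappa_le k (p ^ a)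
        have hτ' := tau_nonneg k (p ^ a)
        calc (1 - u)⁻¹ * (|kappa k (p ^ a)| * |divId (kappa j) (p ^ b)|) * u ^ a ≤
            2 * (tau k (p ^ a) * divId (tau j) (p ^ b)) * u ^ a := by gcongr
          _ = _ := by ring
  have hsum : Summable fun z : ℕ × ℕ => |gcdKernel h k j (p ^ z.1) (p ^ z.2)| * u ^ z.1 :=
    hbound.summable.of_nonneg_of_le (fun z => by positivity) hle
  refine (hsum.tsum_le_tsum hle hbound.summable).trans ?_
  rw [hbound.tsum_eq]
  have i1 := inv_one_sub_pow_sub_one_le hu0.le hu1 k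
  have i2 := inv_one_sub_pow_sub_one_le hu0.le hu1 j
  have i3 : 0 ≤ (1 - u)⁻¹ ^ k - 1 := by
    rw [sub_nonneg]
    exact one_le_pow₀ ((one_le_inv₀ (by linarith)).2 (by linarith))
  have i4 : 0 ≤ (1 - u)⁻¹ ^ j - 1 := by
    rw [sub_nonneg]
    exact one_le_pow₀ ((one_le_inv₀ (by linarith)).2 (by linarith))
  calc 1 * 1 + 2 * ((u * 1 + ((1 - u)⁻¹ ^ k - 1)) * ((1 - u)⁻¹ ^ j - 1)) ≤
      1 * 1 + 2 * ((u * 1 + k * 2 ^ k * u) * (j * 2 ^ j * u)) := by gcongr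
    _ = _ := by ring

end

/-! ### Absolute convergence and the Euler product of the kernel -/

section

open ArithmeticFunction Finset.HasAntidiagonal

/-- Every `m < N` is composed of primes below `N`, so partial sums are bounded by finite Euler
products, and these by `exp (∑ c)`. -/
lemma summable_of_multiplicative {g : ℕ → ℝ} (hg : ∀ n, 0 ≤ g n) (h0 : g 0 = 0) (h1 : g 1 = 1)
    (hmul : ∀ {m n : ℕ}, m.Coprime n → g (m * n) = g m * g n)
    (hs : ∀ p : ℕ, p.Prime → Summable fun e : ℕ => g (p ^ e)) {c : ℕ → ℝ} (hc : ∀ n, 0 ≤ c n)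
    (hcs : Summable c) (hle : ∀ p : ℕ, p.Prime → ∑' e : ℕ, g (p ^ e) ≤ 1 + c p) :
    Summable g := by
  refine summable_of_sum_range_le (c := Real.exp (∑' n, c n)) hg fun N => ?_
  have key := (EulerProduct.summable_and_hasSum_smoothNumbers_prod_primesBelow_tsum (f := g) h1 hmul
    (fun {p} hp => (hs p hp).norm) N).2
  have key' := hasSum_subtype_iff_indicator.1 key
  calc ∑ m ∈ Finset.range N, g m
      = ∑ m ∈ Finset.range N, (N.smoothNumbers).indicator g m := by
        refine Finset.sum_congr rfl fun m hm => ?_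
        rcases eq_or_ne m 0 with rfl | hm0
        · rw [h0, Set.indicator_apply, h0, ite_self]
        · rw [Set.indicator_of_mem]
          exact Nat.mem_smoothNumbers_of_lt (Nat.pos_of_ne_zero hm0) (Finset.mem_range.1 hm)
    _ ≤ ∏ p ∈ N.primesBelow, ∑' e : ℕ, g (p ^ e) :=
        sum_le_hasSum _ (fun m _ => Set.indicator_nonneg (fun x _ => hg x) m) key'
    _ ≤ ∏ p ∈ N.primesBelow, Real.exp (c p) := by
        refine Finset.prod_le_prod (fun p _ => tsum_nonneg fun e => hg _) fun p hp => ?_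
        refine (hle p (Nat.prime_of_mem_primesBelow hp)).trans ?_
        rw [add_comm]
        exact Real.add_one_le_exp _
    _ = Real.exp (∑ p ∈ N.primesBelow, c p) := (Real.exp_sum _ _).symm
    _ ≤ Real.exp (∑' n, c n) := by
        gcongr
        exact hcs.sum_le_tsum _ fun n _ => hc n

lemma injective_divisorsAntidiagonal_val :
    Function.Injective fun x : Σ m : ℕ, m.divisorsAntidiagonal => (x.2 : ℕ × ℕ) := by
  rintro ⟨m, x, hx⟩ ⟨n, y, hy⟩ hxy
  simp only at hxy
  subst hxy
  rw [Nat.mem_divisorsAntidiagonal] at hx hy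
  obtain rfl : m = n := hx.1.symm.trans hy.1
  rfl

lemma eq_zero_of_notMem_range {H : ℕ × ℕ → ℝ} (h0 : ∀ z : ℕ × ℕ, z.1 * z.2 = 0 → H z = 0) :
    ∀ z ∉ Set.range (fun x : Σ m : ℕ, m.divisorsAntidiagonal => (x.2 : ℕ × ℕ)), H z = 0 := by
  intro z hz
  by_contra hne
  exact hz ⟨⟨z.1 * z.2, z, Nat.mem_divisorsAntidiagonal.2 ⟨rfl, fun h => hne (h0 z h)⟩⟩, rfl⟩

/-- Pairs are grouped by their product; those with a zero coordinate belong to no group, whence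
`h0`. -/
lemma Summable.of_sum_divisorsAntidiagonal {H : ℕ × ℕ → ℝ} (hH : ∀ z, 0 ≤ H z)
    (h0 : ∀ z : ℕ × ℕ, z.1 * z.2 = 0 → H z = 0)
    (hs : Summable fun m : ℕ => ∑ x ∈ m.divisorsAntidiagonal, H x) : Summable H := by
  rw [← injective_divisorsAntidiagonal_val.summable_iff (eq_zero_of_notMem_range h0)]
  rw [summable_sigma_of_nonneg (f := H ∘ fun x : Σ m : ℕ, m.divisorsAntidiagonal =>
    (x.2 : ℕ × ℕ)) fun _ => hH _]
  refine ⟨fun m => (hasSum_fintype _).summable, hs.congr fun m => ?_⟩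
  rw [tsum_fintype]
  exact (Finset.sum_coe_sort m.divisorsAntidiagonal H).symm

lemma HasSum.divisorsAntidiagonal {H : ℕ × ℕ → ℝ} {t : ℝ}
    (h0 : ∀ z : ℕ × ℕ, z.1 * z.2 = 0 → H z = 0) (hs : HasSum H t) :
    HasSum (fun m : ℕ => ∑ x ∈ m.divisorsAntidiagonal, H x) t := by
  rw [← injective_divisorsAntidiagonal_val.hasSum_iff (eq_zero_of_notMem_range h0)] at hs
  refine (hs.sigma fun m => hasSum_fintype _).congr_fun ?_
  intro m
  exact (Finset.sum_coe_sort m.divisorsAntidiagonal H).symm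

lemma gcdKernel_div_eq_zero (h k j : ℕ) (z : ℕ × ℕ) (hz : z.1 * z.2 = 0) :
    gcdKernel h k j z.1 z.2 / z.1 = 0 := by
  rcases Nat.mul_eq_zero.1 hz with h1 | h1
  · rw [h1, gcdKernel_zero_left, zero_div]
  · rw [h1, gcdKernel_zero_right, zero_div]

lemma summable_abs_gcdKernel_div {h : ℕ} (hh : h ≠ 0) (k l : ℕ) :
    Summable fun z : ℕ × ℕ => |gcdKernel h k (l - 1) z.1 z.2| / z.1 := by
  have hG := (multiplicative₂_gcdKernel h k (l - 1)).abs
  set G : ℕ → ℕ → ℝ := fun a b => |gcdKernel h k (l - 1) a b| with hGdef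
  refine Summable.of_sum_divisorsAntidiagonal (fun z => by positivity) (fun z hz => ?_) ?_
  · have := gcdKernel_div_eq_zero h k (l - 1) z hz
    rw [← Nat.abs_cast, ← abs_div, this, abs_zero]
  change Summable (antidiagonalSum G)
  have hsum : ∀ p : ℕ, p.Prime →
      HasSum (fun e : ℕ => antidiagonalSum G (p ^ e))
        (∑' z : ℕ × ℕ, |gcdKernel h k (l - 1) (p ^ z.1) (p ^ z.2)| * (p : ℝ)⁻¹ ^ z.1) := by
    intro p hp
    have h1 := (hasSum_gcdKernel_prime_pow hh k l hp).summable.abs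
    simp_rw [antidiagonalSum_prime_pow G hp]
    refine HasSum.antidiagonal (H := fun z : ℕ × ℕ => G (p ^ z.1) (p ^ z.2) * (p : ℝ)⁻¹ ^ z.1)
      (Summable.hasSum (h1.congr fun z => ?_))
    rw [abs_mul, abs_of_nonneg (a := (p : ℝ)⁻¹ ^ z.1) (by positivity)]
  set C : ℝ := 2 * ((l - 1 : ℕ) * 2 ^ (l - 1)) * (1 + k * 2 ^ k)
  have hC : 0 ≤ C := by positivity
  -- The bound `1 + O(p^(-2))` is available only for `p ∤ h`; at the finitely many divisors of `h`
  -- the local sum itself is used as the bound.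
  let c : ℕ → ℝ := fun p => C * ((p : ℝ)⁻¹) ^ 2 +
    if p ∣ h then ∑' z : ℕ × ℕ, |gcdKernel h k (l - 1) (p ^ z.1) (p ^ z.2)| * (p : ℝ)⁻¹ ^ z.1 else 0
  have ht : ∀ p : ℕ, 0 ≤
      ∑' z : ℕ × ℕ, |gcdKernel h k (l - 1) (p ^ z.1) (p ^ z.2)| * (p : ℝ)⁻¹ ^ z.1 :=
    fun p => tsum_nonneg fun z => by positivity
  refine summable_of_multiplicative (c := c) (fun n => ?_) (antidiagonalSum_zero G)
    (antidiagonalSum_one hG) (fun hmn => antidiagonalSum_mul hG hmn)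
    (fun p hp => (hsum p hp).summable) (fun n => ?_) ?_ fun p hp => ?_
  · exact Finset.sum_nonneg fun x _ => by positivity
  · refine add_nonneg (by positivity) ?_
    split_ifs
    exacts [ht n, le_rfl]
  · refine Summable.add ?_ (summable_of_ne_finset_zero (s := h.divisors) fun p hp => ?_)
    · simp_rw [inv_pow]
      exact (Real.summable_nat_pow_inv.2 one_lt_two).mul_left C
    · rw [if_neg]
      exact fun hd => hp (Nat.mem_divisors.2 ⟨hd, hh⟩)
  · rw [(hsum p hp).tsum_eq]
    by_cases hd : p ∣ h
    · simp only [c, if_pos hd]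
      have : 0 ≤ C * ((p : ℝ)⁻¹) ^ 2 := by positivity
      linarith
    · simp only [c, if_neg hd, add_zero]
      exact tsum_abs_gcdKernel_prime_pow_le hh k (l - 1) hp hd

lemma numeratorF_zero (k l : ℕ) {p : ℕ} (hp : p.Prime) :
    numeratorF k l p 0 =
      (1 - (p : ℝ)⁻¹) * (1 - (p : ℝ)⁻¹)⁻¹ ^ k + ((1 - (p : ℝ)⁻¹)⁻¹ ^ (l - 1) - 1) := by
  obtain ⟨hu0, hu1⟩ := hp.inv_mem
  have h1 := (localSum_tau hp hu0.le (by linarith) k).2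
  have h2 := (localSum_tau hp hu0.le (by linarith) (l - 1)).hasSum
  rw [← hasSum_nat_add_iff' 1] at h2
  have h2 := h2.tsum_eq
  simp only [tau_apply, inv_pow] at h1 h2
  have hone : ∀ m, divisorK m 1 = 1 := fun m => by
    have := (isMultiplicative_tau m).1
    rw [tau_apply] at this
    exact_mod_cast this
  rw [numeratorF]
  simp only [zero_add, Finset.sum_range_one, pow_zero, hone, Nat.cast_one, one_mul]
  rw [h1]
  simp only [Finset.sum_range_one, pow_zero, hone, Nat.cast_one, inv_one, mul_one] at h2
  simp_rw [add_comm 1, h2]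
  simp [inv_pow]

/-- Up to the positive factor `1 - 1/p`, it is a sum of nonnegative weights whose term at the origin
is `1`. -/
lemma numeratorF_pos {h : ℕ} (hh : h ≠ 0) (k l : ℕ) {p : ℕ} (hp : p.Prime) :
    0 < numeratorF k l p (h.factorization p) := by
  obtain ⟨hu0, hu1⟩ := hp.inv_mem
  have h1 := hasSum_gcdWeight_prime_pow hh k l hp
  have h2 := le_hasSum h1 (0, 0) fun z _ => mul_nonneg (gcdWeight_nonneg _ _ _ _ _) (by positivity)
  simp only [pow_zero, (multiplicative₂_gcdWeight h k (l - 1)).1, mul_one] at h2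
  have h3 : 0 < 1 - (p : ℝ)⁻¹ := by linarith
  have := lt_of_lt_of_le one_pos h2
  exact (div_pos_iff_of_pos_right h3).1 this

lemma denominator_pos (k l : ℕ) (hk : 1 ≤ k) {p : ℕ} (hp : p.Prime) :
    0 < (1 - (p : ℝ)⁻¹) ^ (1 - (k : ℤ)) + (1 - (p : ℝ)⁻¹) ^ (1 - (l : ℤ)) - 1 := by
  obtain ⟨hu0, hu1⟩ := hp.inv_mem
  have hv0 : 0 < 1 - (p : ℝ)⁻¹ := by linarith
  have h1 : 1 ≤ (1 - (p : ℝ)⁻¹) ^ (1 - (k : ℤ)) :=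
    one_le_zpow_of_nonpos₀ hv0 (by linarith) (by lia)
  have h2 : 0 < (1 - (p : ℝ)⁻¹) ^ (1 - (l : ℤ)) := zpow_pos hv0 _
  linarith

lemma zpow_one_sub_natCast_eq {v : ℝ} {k : ℕ} (hk : 1 ≤ k) :
    v ^ (1 - (k : ℤ)) = (v ^ (k - 1))⁻¹ := by
  obtain ⟨m, rfl⟩ := Nat.exists_eq_add_of_le' hk
  rw [Nat.add_sub_cancel, ← zpow_natCast, ← zpow_neg]
  congr 1
  push_cast
  ring

/-- The factor of `constC k l` at `p`. -/
noncomputable def factorC (k l p : ℕ) : ℝ :=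
  (1 - (p : ℝ)⁻¹) ^ (l - 1) + (1 - (p : ℝ)⁻¹) ^ (k - 1) - (1 - (p : ℝ)⁻¹) ^ (k + l - 2)

/-- The factor of `factorF k l h` at `p`. -/
noncomputable def ratioF (k l h p : ℕ) : ℝ :=
  numeratorF k l p (h.factorization p) /
    ((1 - (p : ℝ)⁻¹) ^ (1 - (k : ℤ)) + (1 - (p : ℝ)⁻¹) ^ (1 - (l : ℤ)) - 1)

/-- With `v = 1 - 1/p`, the factor of `C` is `v^(k+l-2)` times the denominator in `f`, so the
denominators cancel. -/
lemma localFactor_eq {h k l : ℕ} (hk : 1 ≤ k) (hl : 1 ≤ l) {p : ℕ}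
    (hp : p.Prime) :
    (1 - (p : ℝ)⁻¹) ^ k * ((1 - (p : ℝ)⁻¹) ^ (l - 1) *
      (numeratorF k l p (h.factorization p) / (1 - (p : ℝ)⁻¹))) =
      factorC k l p * ratioF k l h p := by
  have hd := (denominator_pos k l hk hp).ne'
  obtain ⟨hu0, hu1⟩ := hp.inv_mem
  have hv0 : (1 - (p : ℝ)⁻¹) ≠ 0 := by linarith
  rw [factorC, ratioF]
  rw [zpow_one_sub_natCast_eq hk, zpow_one_sub_natCast_eq hl] at hd ⊢
  obtain ⟨m, rfl⟩ := Nat.exists_eq_add_of_le' hk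
  obtain ⟨n, rfl⟩ := Nat.exists_eq_add_of_le' hl
  have e : m + 1 + (n + 1) - 2 = m + n := by lia
  simp only [Nat.add_sub_cancel, e] at hd ⊢
  have e2 : (1 - (p : ℝ)⁻¹) ^ n + (1 - (p : ℝ)⁻¹) ^ m - (1 - (p : ℝ)⁻¹) ^ (m + n) =
      (1 - (p : ℝ)⁻¹) ^ (m + n) * (((1 - (p : ℝ)⁻¹) ^ m)⁻¹ + ((1 - (p : ℝ)⁻¹) ^ n)⁻¹ - 1) := by
    generalize 1 - (p : ℝ)⁻¹ = v at hv0
    rw [pow_add]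
    field_simp
  rw [e2, mul_assoc, mul_div_cancel₀ _ hd]
  generalize numeratorF (m + 1) (n + 1) p (h.factorization p) = N
  generalize 1 - (p : ℝ)⁻¹ = v at hv0
  field_simp
  ring

lemma ratioF_of_not_dvd {h k l : ℕ} (hk : 1 ≤ k) (hl : 1 ≤ l) {p : ℕ} (hp : p.Prime)
    (hd : ¬ p ∣ h) : ratioF k l h p = 1 := by
  have hd' := (denominator_pos k l hk hp).ne'
  obtain ⟨hu0, hu1⟩ := hp.inv_mem
  have hv0 : (1 - (p : ℝ)⁻¹) ≠ 0 := by linarith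
  rw [ratioF, Nat.factorization_eq_zero_of_not_dvd hd, numeratorF_zero k l hp,
    div_eq_one_iff_eq hd', zpow_one_sub_natCast_eq hk, zpow_one_sub_natCast_eq hl, inv_pow, inv_pow]
  obtain ⟨m, rfl⟩ := Nat.exists_eq_add_of_le' hk
  rw [Nat.add_sub_cancel]
  generalize 1 - (p : ℝ)⁻¹ = v at hv0
  field_simp
  ring

lemma ratioF_pos {h k l : ℕ} (hh : h ≠ 0) (hk : 1 ≤ k) {p : ℕ} (hp : p.Prime) :
    0 < ratioF k l h p :=
  div_pos (numeratorF_pos hh k l hp) (denominator_pos k l hk hp)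

lemma factorF_pos {h k l : ℕ} (hh : h ≠ 0) (hk : 1 ≤ k) : 0 < factorF k l h :=
  Finset.prod_pos fun _ hp => ratioF_pos hh hk (Nat.prime_of_mem_primeFactors hp)

lemma hasProd_ratioF {h k l : ℕ} (hh : h ≠ 0) (hk : 1 ≤ k) (hl : 1 ≤ l) :
    HasProd (fun p : Nat.Primes => ratioF k l h p) (factorF k l h) := by
  change HasProd (ratioF k l h ∘ Subtype.val (p := (· ∈ {x | Nat.Prime x}))) _
  rw [hasProd_subtype_iff_mulIndicator]
  have h1 : ∏ p ∈ h.primeFactors, Set.mulIndicator {x | Nat.Prime x} (ratioF k l h) p =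
      factorF k l h := by
    refine Finset.prod_congr rfl fun p hp => ?_
    rw [Set.mulIndicator_of_mem (s := {x | Nat.Prime x}) (Nat.prime_of_mem_primeFactors hp)]
    rfl
  rw [← h1]
  refine hasProd_prod_of_ne_finset_one fun p hp => ?_
  by_cases hpp : p.Prime
  · rw [Set.mulIndicator_of_mem (by exact hpp)]
    exact ratioF_of_not_dvd hk hl hpp fun hd => hp (Nat.mem_primeFactors.2 ⟨hpp, hd, hh⟩)
  · rw [Set.mulIndicator_of_notMem (by exact hpp)]

/-- The factor of `C` minus `1` is `-(1 - v^(k-1)) (1 - v^(l-1))` with `v = 1 - 1/p`, and each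
bracket is `O(1/p)`. -/
lemma summable_abs_factorC_sub_one {k l : ℕ} (hk : 1 ≤ k) (hl : 1 ≤ l) :
    Summable fun p : Nat.Primes => ‖factorC k l p - 1‖ := by
  have hs : Summable fun p : Nat.Primes =>
      ((k - 1 : ℕ) : ℝ) * ((l - 1 : ℕ) : ℝ) * (((p : ℕ) : ℝ) ^ 2)⁻¹ :=
    ((Real.summable_nat_pow_inv.2 one_lt_two).comp_injective
      Nat.Primes.coe_nat_injective).mul_left _
  refine hs.of_nonneg_of_le (fun p => norm_nonneg _) fun p => ?_
  obtain ⟨hu0, hu1⟩ := p.2.inv_mem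
  have hb : ∀ m : ℕ, 0 ≤ 1 - (1 - ((p : ℕ) : ℝ)⁻¹) ^ m ∧
      1 - (1 - ((p : ℕ) : ℝ)⁻¹) ^ m ≤ m * ((p : ℕ) : ℝ)⁻¹ := by
    intro m
    have h1 := one_add_mul_le_pow (a := -((p : ℕ) : ℝ)⁻¹) (by linarith) m
    rw [← sub_eq_add_neg] at h1
    have h2 : (1 - ((p : ℕ) : ℝ)⁻¹) ^ m ≤ 1 := pow_le_one₀ (by linarith) (by linarith)
    exact ⟨by linarith, by linarith⟩
  have e : factorC k l p - 1 =
      -((1 - (1 - ((p : ℕ) : ℝ)⁻¹) ^ (k - 1)) * (1 - (1 - ((p : ℕ) : ℝ)⁻¹) ^ (l - 1))) := by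
    rw [factorC, show k + l - 2 = (k - 1) + (l - 1) by lia, pow_add]
    ring
  rw [e, norm_neg, Real.norm_of_nonneg (mul_nonneg (hb _).1 (hb _).1)]
  calc _ ≤ (((k - 1 : ℕ) : ℝ) * ((p : ℕ) : ℝ)⁻¹) * (((l - 1 : ℕ) : ℝ) * ((p : ℕ) : ℝ)⁻¹) :=
        mul_le_mul (hb _).2 (hb _).2 (hb _).1 (by positivity)
    _ = _ := by ring

lemma hasProd_factorC {k l : ℕ} (hk : 1 ≤ k) (hl : 1 ≤ l) :
    HasProd (fun p : Nat.Primes => factorC k l p) (constC k l) := by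
  have h := (multipliable_one_add_of_summable (summable_abs_factorC_sub_one hk hl)).hasProd
  simp only [add_sub_cancel] at h
  exact h

/-- No factor vanishes, since `v^(k+l-2) ≤ v^(k-1)` leaves at least `v^(l-1) > 0`; absolute
convergence excludes a zero limit. -/
lemma constC_ne_zero {k l : ℕ} (hk : 1 ≤ k) (hl : 1 ≤ l) : constC k l ≠ 0 := by
  have h := tprod_one_add_ne_zero_of_summable (f := fun p : Nat.Primes => factorC k l p - 1)
    (fun p => ?_) (summable_abs_factorC_sub_one hk hl)
  · simp only [add_sub_cancel] at h
    exact h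
  · obtain ⟨hu0, hu1⟩ := p.2.inv_mem
    have h1 : 0 < (1 - ((p : ℕ) : ℝ)⁻¹) ^ (l - 1) := pow_pos (by linarith) _
    have h2 : (1 - ((p : ℕ) : ℝ)⁻¹) ^ (k + l - 2) ≤ (1 - ((p : ℕ) : ℝ)⁻¹) ^ (k - 1) :=
      pow_le_pow_of_le_one (by linarith) (by linarith) (by lia)
    rw [add_sub_cancel, factorC]
    linarith

lemma tsum_gcdKernel_div {h k l : ℕ} (hh : h ≠ 0) (hk : 1 ≤ k) (hl : 1 ≤ l) :
    ∑' z : ℕ × ℕ, gcdKernel h k (l - 1) z.1 z.2 / z.1 = constC k l * factorF k l h := by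
  have habs := summable_abs_gcdKernel_div hh k l
  have hs : Summable fun z : ℕ × ℕ => gcdKernel h k (l - 1) z.1 z.2 / z.1 := by
    refine Summable.of_norm (habs.congr fun z => ?_)
    rw [norm_div, Real.norm_natCast, Real.norm_eq_abs]
  have hG := multiplicative₂_gcdKernel h k (l - 1)
  set G := gcdKernel h k (l - 1) with hGdef
  have h1 : HasSum (antidiagonalSum G) (∑' z : ℕ × ℕ, G z.1 z.2 / z.1) :=
    hs.hasSum.divisorsAntidiagonal (gcdKernel_div_eq_zero h k (l - 1))
  have h2 := EulerProduct.eulerProduct_hasProd (f := antidiagonalSum G) (antidiagonalSum_one hG)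
    (fun hmn => antidiagonalSum_mul hG hmn) h1.summable.norm (antidiagonalSum_zero G)
  rw [h1.tsum_eq] at h2
  refine h2.unique ?_
  refine ((hasProd_factorC hk hl).mul (hasProd_ratioF hh hk hl)).congr_fun ?_
  intro p
  rw [← localFactor_eq hk hl p.2, ← (hasSum_gcdKernel_prime_pow hh k l p.2).antidiagonal.tsum_eq]
  exact tsum_congr fun e => antidiagonalSum_prime_pow G p.2 e

end

/-! ### Summatory functions of `d_j(n)/n` and `d_j(n)` -/

section

open ArithmeticFunction
open scoped ArithmeticFunction.zeta

/-- The summatory function `∑_{n ≤ x} f(n)`. -/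
noncomputable def summatory (f : ArithmeticFunction ℝ) (x : ℝ) : ℝ := ∑ n ∈ Finset.Ioc 0 ⌊x⌋₊, f n

lemma summatory_mul (f g : ArithmeticFunction ℝ) (x : ℝ) :
    summatory (f * g) x = ∑ n ∈ Finset.Ioc 0 ⌊x⌋₊, f n * summatory g (x / n) := by
  rw [summatory, sum_Ioc_mul_eq_sum_sum]
  simp_rw [summatory, Nat.floor_div_natCast]

lemma summatory_one {x : ℝ} (hx : 1 ≤ x) : summatory 1 x = 1 := by
  rw [summatory, Finset.sum_eq_single_of_mem 1]
  · simp
  · exact Finset.mem_Ioc.2 ⟨one_pos, Nat.floor_pos.2 hx⟩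
  · intro b _ hb
    exact one_apply_ne hb

lemma summatory_of_lt_one (f : ArithmeticFunction ℝ) {x : ℝ} (hx : x < 1) : summatory f x = 0 := by
  rw [summatory, Nat.floor_eq_zero.2 hx, Finset.Ioc_self, Finset.sum_empty]

lemma summatory_nonneg {f : ArithmeticFunction ℝ} (hf : ∀ n, 0 ≤ f n) (x : ℝ) :
    0 ≤ summatory f x := Finset.sum_nonneg fun n _ => hf n

lemma mem_Ioc_floor {x : ℝ} {n : ℕ} (hn : n ∈ Finset.Ioc 0 ⌊x⌋₊) : 0 < n ∧ (n : ℝ) ≤ x := by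
  rw [Finset.mem_Ioc] at hn
  exact ⟨hn.1, (Nat.le_floor_iff' hn.1.ne').1 hn.2⟩

lemma summatory_divId_tau_succ (j : ℕ) (y : ℝ) :
    summatory (divId (tau (j + 1))) y =
      ∑ m ∈ Finset.Ioc 0 ⌊y⌋₊, (m : ℝ)⁻¹ * summatory (divId (tau j)) (y / m) := by
  rw [tau_succ, divId_mul, summatory_mul]
  refine Finset.sum_congr rfl fun m hm => ?_
  rw [divId_apply, natCoe_apply, zeta_apply_ne (mem_Ioc_floor hm).1.ne', Nat.cast_one, one_div]

lemma summatory_divId_tau_le (j : ℕ) {y : ℝ} (hy : 1 ≤ y) :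
    summatory (divId (tau j)) y ≤ (1 + Real.log y) ^ j := by
  induction j generalizing y with
  | zero => rw [tau_zero, divId_one, summatory_one hy, pow_zero]
  | succ j ih =>
    have hlog : 0 ≤ Real.log y := Real.log_nonneg hy
    rw [summatory_divId_tau_succ, pow_succ']
    calc ∑ m ∈ Finset.Ioc 0 ⌊y⌋₊, (m : ℝ)⁻¹ * summatory (divId (tau j)) (y / m)
        ≤ ∑ m ∈ Finset.Ioc 0 ⌊y⌋₊, (m : ℝ)⁻¹ * (1 + Real.log y) ^ j := by
          refine Finset.sum_le_sum fun m hm => ?_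
          obtain ⟨hm0, hmy⟩ := mem_Ioc_floor hm
          have hm1 : (1 : ℝ) ≤ m := by exact_mod_cast hm0
          have h1 : 1 ≤ y / m := (one_le_div (by positivity)).2 hmy
          have h2 : y / m ≤ y := div_le_self (by linarith) hm1
          have h3 : Real.log (y / m) ≤ Real.log y := Real.log_le_log (by linarith) h2
          have h4 : 0 ≤ Real.log (y / m) := Real.log_nonneg h1
          gcongr
          refine (ih h1).trans ?_
          gcongr
      _ = (∑ m ∈ Finset.Ioc 0 ⌊y⌋₊, (m : ℝ)⁻¹) * (1 + Real.log y) ^ j := by rw [Finset.sum_mul]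
      _ ≤ (1 + Real.log y) * (1 + Real.log y) ^ j := by
          gcongr
          have h := harmonic_floor_le_one_add_log y hy
          rw [harmonic_eq_sum_Icc] at h
          push_cast at h
          exact h

lemma pow_succ_sub_pow_succ_le {a b : ℝ} (hb : 0 ≤ b) (hab : b ≤ a) (n : ℕ) :
    a ^ (n + 1) - b ^ (n + 1) ≤ (n + 1) * a ^ n * (a - b) := by
  induction n with
  | zero => simp
  | succ n ih =>
    have h1 : b ^ (n + 1) ≤ a ^ (n + 1) := pow_le_pow_left₀ hb hab _
    have ha : 0 ≤ a := hb.trans hab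
    have h2 := mul_le_mul_of_nonneg_left ih ha
    have h3 := mul_le_mul_of_nonneg_right h1 (sub_nonneg.2 hab)
    push_cast
    calc a ^ (n + 1 + 1) - b ^ (n + 1 + 1)
        = a * (a ^ (n + 1) - b ^ (n + 1)) + b ^ (n + 1) * (a - b) := by ring
      _ ≤ a * ((n + 1) * a ^ n * (a - b)) + a ^ (n + 1) * (a - b) := add_le_add h2 h3
      _ = _ := by ring

lemma le_pow_succ_sub_pow_succ {a b : ℝ} (hb : 0 ≤ b) (hab : b ≤ a) (n : ℕ) :
    (n + 1) * b ^ n * (a - b) ≤ a ^ (n + 1) - b ^ (n + 1) := by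
  induction n with
  | zero => simp
  | succ n ih =>
    have ha : 0 ≤ a := hb.trans hab
    have h0 : 0 ≤ (n + 1) * b ^ n * (a - b) :=
      mul_nonneg (by positivity) (sub_nonneg.2 hab)
    have h2 := mul_le_mul hab ih h0 ha
    push_cast
    calc ((n : ℝ) + 1 + 1) * b ^ (n + 1) * (a - b)
        = b * ((n + 1) * b ^ n * (a - b)) + b ^ (n + 1) * (a - b) := by ring
      _ ≤ a * (a ^ (n + 1) - b ^ (n + 1)) + b ^ (n + 1) * (a - b) := by gcongr
      _ = _ := by ring

lemma sum_Ioc_zero_eq_sum_range (f : ℕ → ℝ) (N : ℕ) :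
    ∑ n ∈ Finset.Ioc 0 N, f n = ∑ i ∈ Finset.range N, f (i + 1) := by
  rw [Finset.range_eq_Ico, Finset.sum_Ico_add' f 0 N 1, Finset.Ico_add_one_add_one_eq_Ioc]

/-- A discrete form of `∫ log^j(y/t) dt/t = log^(j+1) y/(j+1)`: telescope the powers
`log^(j+1)(y/m)`, using `log(m+1) - log m ≤ 1/m`. -/
lemma log_pow_succ_le_sum (j : ℕ) {y : ℝ} (hy : 1 ≤ y) :
    Real.log y ^ (j + 1) ≤
      (j + 1) * ∑ m ∈ Finset.Ioc 0 ⌊y⌋₊, (m : ℝ)⁻¹ * Real.log (y / m) ^ j := by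
  -- The truncation at `0` makes the telescoping sum end at exactly `0`.
  let a : ℕ → ℝ := fun i => max (Real.log (y / (i + 1 : ℕ))) 0
  have htel := Finset.sum_range_sub' (fun i => a i ^ (j + 1)) ⌊y⌋₊
  have ha0 : a 0 = Real.log y := by
    simp [a, Real.log_nonneg hy]
  have haN : a ⌊y⌋₊ = 0 := by
    refine max_eq_right (Real.log_nonpos (by positivity) ?_)
    rw [div_le_one (by positivity)]
    push_cast
    exact (Nat.lt_floor_add_one y).le
  simp only [ha0, haN, zero_pow (Nat.succ_ne_zero j), sub_zero] at htel
  rw [← htel, Finset.mul_sum, sum_Ioc_zero_eq_sum_range]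
  refine Finset.sum_le_sum fun i hi => ?_
  have hi' : ((i + 1 : ℕ) : ℝ) ≤ y :=
    (Nat.le_floor_iff (by linarith)).1 (Finset.mem_range.1 hi)
  have hi0 : (0 : ℝ) < (i + 1 : ℕ) := by positivity
  have hy0 : 0 < y := by linarith
  have hlog : 0 ≤ Real.log (y / (i + 1 : ℕ)) := Real.log_nonneg ((one_le_div hi0).2 hi')
  have hai : a i = Real.log (y / (i + 1 : ℕ)) := max_eq_left hlog
  have hle : a (i + 1) ≤ a i := by
    rw [hai]
    refine max_le (Real.log_le_log (by positivity) ?_) hlog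
    gcongr
    lia
  have hd : a i - a (i + 1) ≤ ((i + 1 : ℕ) : ℝ)⁻¹ := by
    have h1 : Real.log (y / (i + 1 + 1 : ℕ)) ≤ a (i + 1) := le_max_left _ _
    rw [Real.log_div hy0.ne' (by positivity)] at h1
    rw [hai, Real.log_div hy0.ne' hi0.ne']
    have h2 := Real.log_le_sub_one_of_pos (x := ((i + 1 + 1 : ℕ) : ℝ) / (i + 1 : ℕ)) (by positivity)
    rw [Real.log_div (by positivity) hi0.ne'] at h2
    have h3 : ((i + 1 + 1 : ℕ) : ℝ) / (i + 1 : ℕ) - 1 = ((i + 1 : ℕ) : ℝ)⁻¹ := by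
      rw [Nat.cast_succ (i + 1)]
      field_simp
      ring
    linarith
  refine (pow_succ_sub_pow_succ_le (le_max_right _ _) hle j).trans ?_
  have ha : 0 ≤ a i := le_max_right _ _
  rw [← hai]
  calc ((j : ℝ) + 1) * a i ^ j * (a i - a (i + 1))
      ≤ ((j : ℝ) + 1) * a i ^ j * ((i + 1 : ℕ) : ℝ)⁻¹ := by gcongr
    _ = _ := by ring

/-- The matching upper bound, from `1/(m+1) ≤ log(m+1) - log m`. This leaves the term `m = 1`, which
is absorbed by raising the shift from `c` to `c + 1`; the free shift lets the bound be iterated. -/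
lemma sum_le_log_add_pow_succ (j : ℕ) {y c : ℝ} (hy : 1 ≤ y) (hc : 0 ≤ c) :
    (j + 1) * ∑ m ∈ Finset.Ioc 0 ⌊y⌋₊, (m : ℝ)⁻¹ * (Real.log (y / m) + c) ^ j ≤
      (Real.log y + (c + 1)) ^ (j + 1) := by
  have hy0 : 0 < y := by linarith
  let a : ℕ → ℝ := fun i => Real.log (y / (i + 1 : ℕ)) + c
  obtain ⟨N, hN⟩ : ∃ N, ⌊y⌋₊ = N + 1 := ⟨⌊y⌋₊ - 1, by have := Nat.floor_pos.2 hy; lia⟩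
  have hpos : ∀ i, i ≤ N → 0 ≤ a i := by
    intro i hi
    have hi' : ((i + 1 : ℕ) : ℝ) ≤ y := (Nat.le_floor_iff hy0.le).1 (by lia)
    exact add_nonneg (Real.log_nonneg ((one_le_div (by positivity)).2 hi')) hc
  have ha0 : a 0 = Real.log y + c := by simp [a]
  have hterm : ∀ i ∈ Finset.range N,
      ((j : ℝ) + 1) * (((i + 1 + 1 : ℕ) : ℝ)⁻¹ * (Real.log (y / (i + 1 + 1 : ℕ)) + c) ^ j) ≤
        a i ^ (j + 1) - a (i + 1) ^ (j + 1) := by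
    intro i hi
    have hiN := Finset.mem_range.1 hi
    have hle : a (i + 1) ≤ a i := by
      simp only [a]
      gcongr
      lia
    have h1 : ((i + 1 + 1 : ℕ) : ℝ)⁻¹ ≤ a i - a (i + 1) := by
      have h2 := Real.log_le_sub_one_of_pos (x := ((i + 1 : ℕ) : ℝ) / (i + 1 + 1 : ℕ))
        (by positivity)
      rw [Real.log_div (by positivity) (by positivity)] at h2
      have h3 : ((i + 1 : ℕ) : ℝ) / (i + 1 + 1 : ℕ) - 1 = -((i + 1 + 1 : ℕ) : ℝ)⁻¹ := by
        rw [Nat.cast_succ (i + 1)]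
        field_simp
        ring
      simp only [a]
      rw [Real.log_div hy0.ne' (by positivity), Real.log_div hy0.ne' (by positivity)]
      linarith
    refine le_trans ?_ (le_pow_succ_sub_pow_succ (hpos (i + 1) (by lia)) hle j)
    have := hpos (i + 1) (by lia)
    calc ((j : ℝ) + 1) * (((i + 1 + 1 : ℕ) : ℝ)⁻¹ * a (i + 1) ^ j)
        = ((j : ℝ) + 1) * a (i + 1) ^ j * ((i + 1 + 1 : ℕ) : ℝ)⁻¹ := by ring
      _ ≤ _ := by gcongr
  have hsum := Finset.sum_le_sum hterm
  rw [Finset.sum_range_sub' fun i => a i ^ (j + 1)] at hsum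
  rw [sum_Ioc_zero_eq_sum_range, hN, Finset.sum_range_succ', mul_add, Finset.mul_sum]
  have hN0 : 0 ≤ a N ^ (j + 1) := pow_nonneg (hpos N le_rfl) _
  have hX : 0 ≤ Real.log y + c := add_nonneg (Real.log_nonneg hy) hc
  have hlast := le_pow_succ_sub_pow_succ hX (by linarith : Real.log y + c ≤ Real.log y + (c + 1)) j
  rw [ha0] at hsum
  simp only [zero_add, Nat.cast_one, inv_one, one_mul, div_one]
  have e : Real.log y + (c + 1) - (Real.log y + c) = 1 := by ring
  rw [e, mul_one] at hlast
  linarith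

lemma log_pow_le_factorial_mul_summatory (j : ℕ) {y : ℝ} (hy : 1 ≤ y) :
    Real.log y ^ j ≤ j.factorial * summatory (divId (tau j)) y := by
  induction j generalizing y with
  | zero => rw [tau_zero, divId_one, summatory_one hy]; simp
  | succ j ih =>
    refine (log_pow_succ_le_sum j hy).trans ?_
    rw [summatory_divId_tau_succ, Nat.factorial_succ]
    push_cast
    rw [mul_assoc, Finset.mul_sum (a := (j.factorial : ℝ))]
    refine mul_le_mul_of_nonneg_left (Finset.sum_le_sum fun m hm => ?_) (by positivity)
    obtain ⟨hm0, hmy⟩ := mem_Ioc_floor hm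
    have hm1 : (0 : ℝ) < m := by exact_mod_cast hm0
    rw [mul_left_comm]
    gcongr
    exact ih ((one_le_div hm1).2 hmy)

/-- Each induction step raises the shift by `1`, so it is `j` after `j` steps. -/
lemma factorial_mul_summatory_le (j : ℕ) {y : ℝ} (hy : 1 ≤ y) :
    j.factorial * summatory (divId (tau j)) y ≤ (Real.log y + j) ^ j := by
  induction j generalizing y with
  | zero => rw [tau_zero, divId_one, summatory_one hy]; simp
  | succ j ih =>
    have h := sum_le_log_add_pow_succ j hy j.cast_nonneg
    rw [Nat.cast_succ]
    refine le_trans ?_ h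
    rw [summatory_divId_tau_succ, Nat.factorial_succ]
    push_cast
    rw [mul_assoc, Finset.mul_sum (a := (j.factorial : ℝ))]
    refine mul_le_mul_of_nonneg_left (Finset.sum_le_sum fun m hm => ?_) (by positivity)
    obtain ⟨hm0, hmy⟩ := mem_Ioc_floor hm
    have hm1 : (0 : ℝ) < m := by exact_mod_cast hm0
    rw [mul_left_comm]
    gcongr
    exact ih ((one_le_div hm1).2 hmy)

lemma tendsto_summatory_divId_tau (j : ℕ) :
    Tendsto (fun y : ℝ => summatory (divId (tau j)) y / Real.log y ^ j) atTop
      (𝓝 (j.factorial : ℝ)⁻¹) := by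
  have hlim : Tendsto (fun y : ℝ => (j.factorial : ℝ)⁻¹ * (1 + j * (Real.log y)⁻¹) ^ j) atTop
      (𝓝 (j.factorial : ℝ)⁻¹) := by
    have h1 : Tendsto (fun y : ℝ => (Real.log y)⁻¹) atTop (𝓝 0) :=
      tendsto_inv_atTop_zero.comp Real.tendsto_log_atTop
    have h2 := ((((h1.const_mul (j : ℝ)).const_add 1).pow j).const_mul (j.factorial : ℝ)⁻¹)
    simpa using h2
  have hf : (0 : ℝ) < j.factorial := by exact_mod_cast j.factorial_pos
  refine tendsto_of_tendsto_of_tendsto_of_le_of_le' tendsto_const_nhds hlim ?_ ?_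
  · filter_upwards [eventually_gt_atTop 1] with y hy
    have hl : 0 < Real.log y := Real.log_pos hy
    rw [le_div_iff₀ (by positivity), inv_mul_le_iff₀ hf]
    exact log_pow_le_factorial_mul_summatory j hy.le
  · filter_upwards [eventually_gt_atTop 1] with y hy
    have hl : 0 < Real.log y := Real.log_pos hy
    rw [div_le_iff₀ (by positivity), mul_assoc, ← mul_pow, ← div_eq_inv_mul, le_div_iff₀ hf,
      mul_comm]
    refine (factorial_mul_summatory_le j hy.le).trans_eq ?_
    congr 1
    field_simp

/-- Since `τ_{j+1} = τ_j * 1`, each `n` is counted `⌊x/n⌋` times, and `x/n - 1 < ⌊x/n⌋ ≤ x/n`. -/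
lemma summatory_tau_succ_bounds (j : ℕ) {x : ℝ} (hx : 0 ≤ x) :
    summatory (tau (j + 1)) x ≤ x * summatory (divId (tau j)) x ∧
      x * summatory (divId (tau j)) x - summatory (tau j) x ≤ summatory (tau (j + 1)) x := by
  have h : summatory (tau (j + 1)) x =
      ∑ n ∈ Finset.Ioc 0 ⌊x⌋₊, tau j n * (⌊x / n⌋₊ : ℝ) := by
    rw [tau_succ, mul_comm, summatory, sum_Ioc_mul_zeta_eq_sum]
    simp_rw [Nat.floor_div_natCast]
  rw [h]
  simp only [summatory]
  rw [Finset.mul_sum, ← Finset.sum_sub_distrib]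
  refine ⟨Finset.sum_le_sum fun n hn => ?_, Finset.sum_le_sum fun n hn => ?_⟩
  · calc tau j n * (⌊x / n⌋₊ : ℝ) ≤ tau j n * (x / n) :=
        mul_le_mul_of_nonneg_left (Nat.floor_le (by positivity)) (tau_nonneg j n)
      _ = x * divId (tau j) n := by rw [divId_apply]; ring
  · calc x * divId (tau j) n - tau j n = tau j n * (x / n - 1) := by rw [divId_apply]; ring
      _ ≤ tau j n * (⌊x / n⌋₊ : ℝ) :=
        mul_le_mul_of_nonneg_left (Nat.sub_one_lt_floor _).le (tau_nonneg j n)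

lemma summatory_tau_le (j : ℕ) {x : ℝ} (hx : 1 ≤ x) :
    summatory (tau (j + 1)) x ≤ x * (1 + Real.log x) ^ j := by
  refine (summatory_tau_succ_bounds j (by linarith)).1.trans ?_
  gcongr
  exact summatory_divId_tau_le j hx

lemma tendsto_summatory_tau (j : ℕ) :
    Tendsto (fun x : ℝ => summatory (tau (j + 1)) x / (x * Real.log x ^ j)) atTop
      (𝓝 (j.factorial : ℝ)⁻¹) := by
  have hinv : Tendsto (fun y : ℝ => (Real.log y)⁻¹) atTop (𝓝 0) :=
    tendsto_inv_atTop_zero.comp Real.tendsto_log_atTop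
  have hsmall : Tendsto (fun x : ℝ => summatory (tau j) x / (x * Real.log x ^ j)) atTop (𝓝 0) := by
    cases j with
    | zero =>
      refine tendsto_inv_atTop_zero.congr' ?_
      filter_upwards [eventually_ge_atTop 1] with x hx
      rw [tau_zero, summatory_one hx]
      simp
    | succ j =>
      have hlim : Tendsto (fun x : ℝ => ((Real.log x)⁻¹ + 1) ^ j * (Real.log x)⁻¹) atTop (𝓝 0) := by
        have := ((hinv.add_const 1).pow j).mul hinv
        simpa using this
      refine squeeze_zero' ?_ ?_ hlim
      · filter_upwards [eventually_ge_atTop 1] with x hx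
        exact div_nonneg (summatory_nonneg (tau_nonneg _) x)
          (mul_nonneg (by linarith) (pow_nonneg (Real.log_nonneg hx) _))
      · filter_upwards [eventually_gt_atTop 1] with x hx
        have hl : 0 < Real.log x := Real.log_pos hx
        have hx0 : 0 < x := by linarith
        rw [div_le_iff₀ (by positivity)]
        refine (summatory_tau_le j hx.le).trans_eq ?_
        have e : 1 + Real.log x = ((Real.log x)⁻¹ + 1) * Real.log x := by field_simp
        rw [e, mul_pow]
        field_simp
        ring
  have hE := tendsto_summatory_divId_tau j
  have hlow := hE.sub hsmall
  rw [sub_zero] at hlow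
  refine tendsto_of_tendsto_of_tendsto_of_le_of_le' hlow hE ?_ ?_
  · filter_upwards [eventually_gt_atTop 1] with x hx
    have hl : 0 < Real.log x := Real.log_pos hx
    have hx0 : 0 < x := by linarith
    rw [← mul_div_mul_left _ _ hx0.ne', ← sub_div]
    gcongr
    exact (summatory_tau_succ_bounds j hx0.le).2
  · filter_upwards [eventually_gt_atTop 1] with x hx
    have hl : 0 < Real.log x := Real.log_pos hx
    have hx0 : 0 < x := by linarith
    rw [← mul_div_mul_left (summatory (divId (tau j)) x) _ hx0.ne']
    gcongr
    exact (summatory_tau_succ_bounds j hx0.le).1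

end

/-! ### Asymptotics of the sum of the gcd weight -/

section

open ArithmeticFunction

/-- The sum of `gcdWeight h k j n q` over `n ≤ X` and `q ≤ Q`. -/
noncomputable def sumGcdWeight (h k j : ℕ) (X Q : ℝ) : ℝ :=
  ∑ n ∈ Finset.Ioc 0 ⌊X⌋₊, ∑ q ∈ Finset.Ioc 0 ⌊Q⌋₊, gcdWeight h k j n q

lemma sumGcdWeight_eq_tsum (h k j : ℕ) (X Q : ℝ) :
    sumGcdWeight h k j X Q = ∑' z : ℕ × ℕ, gcdKernel h k j z.1 z.2 *
      (summatory (tau k) (X / z.1) * summatory (divId (tau j)) (Q / z.2)) := by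
  let G : ℕ → ArithmeticFunction ℝ := fun a => ⟨gcdKernel h k j a, gcdKernel_zero_right h k j a⟩
  let A : ArithmeticFunction ℝ := ⟨fun a => summatory (divId (tau j) * G a) Q, by
    refine Finset.sum_eq_zero fun q _ => ?_
    rw [mul_apply]
    refine Finset.sum_eq_zero fun y _ => ?_
    have : G 0 y.2 = 0 := gcdKernel_zero_left h k j y.2
    rw [this, mul_zero]⟩
  have h1 : sumGcdWeight h k j X Q = summatory (tau k * A) X := by
    refine Finset.sum_congr rfl fun n hn => ?_
    have hn0 := (mem_Ioc_floor hn).1.ne'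
    rw [mul_apply]
    have hA : ∀ a, A a = ∑ q ∈ Finset.Ioc 0 ⌊Q⌋₊, ∑ y ∈ q.divisorsAntidiagonal,
        divId (tau j) y.1 * gcdKernel h k j a y.2 := fun a => rfl
    simp_rw [hA, Finset.mul_sum]
    rw [Finset.sum_comm]
    refine Finset.sum_congr rfl fun q hq => ?_
    rw [← conv₂_gcdKernel h k j hn0 (mem_Ioc_floor hq).1.ne']
    simp_rw [conv₂, Finset.mul_sum]
  have h2 : ∀ a, A a = ∑ b ∈ Finset.Ioc 0 ⌊Q⌋₊,
      gcdKernel h k j a b * summatory (divId (tau j)) (Q / b) := by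
    intro a
    have : A a = summatory (G a * divId (tau j)) Q := by
      rw [mul_comm]; rfl
    rw [this, summatory_mul]
    rfl
  -- Outside the box the summatory functions are empty, so the finite sum is a series over all
  -- pairs. For `a = 0` the convention `Y / 0 = 0` gives the same.
  have hzero : ∀ (f : ArithmeticFunction ℝ) (Y : ℝ) (a : ℕ), a ∉ Finset.Ioc 0 ⌊Y⌋₊ →
      summatory f (Y / a) = 0 := by
    intro f Y a ha
    rcases Nat.eq_zero_or_pos a with rfl | ha0
    · exact summatory_of_lt_one f (by simp)
    · refine summatory_of_lt_one f ?_
      rw [div_lt_one (by exact_mod_cast ha0)]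
      rw [Finset.mem_Ioc, not_and, not_le] at ha
      exact Nat.lt_of_floor_lt (ha ha0)
  rw [h1, mul_comm, summatory_mul, tsum_eq_sum (s := Finset.Ioc 0 ⌊X⌋₊ ×ˢ Finset.Ioc 0 ⌊Q⌋₊),
    Finset.sum_product]
  · refine Finset.sum_congr rfl fun a _ => ?_
    rw [h2, Finset.sum_mul]
    exact Finset.sum_congr rfl fun b _ => by ring
  · intro z hz
    rw [Finset.mem_product, not_and_or] at hz
    rcases hz with hz | hz
    · rw [hzero _ _ _ hz, zero_mul, mul_zero]
    · rw [hzero _ _ _ hz, mul_zero, mul_zero]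

lemma tendsto_log_div_const {Y : ℝ → ℝ} {c a : ℝ} (ha : 0 < a) (hY : Tendsto Y atTop atTop)
    (hl : Tendsto (fun x => Real.log (Y x) / Real.log x) atTop (𝓝 c)) :
    Tendsto (fun x => Real.log (Y x / a) / Real.log x) atTop (𝓝 c) := by
  have hinv : Tendsto (fun y : ℝ => Real.log a / Real.log y) atTop (𝓝 0) :=
    tendsto_const_nhds.div_atTop Real.tendsto_log_atTop
  have h := hl.sub hinv
  rw [sub_zero] at h
  refine h.congr' ?_
  filter_upwards [hY.eventually_gt_atTop 0] with x hx
  rw [Real.log_div hx.ne' ha.ne', sub_div]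

lemma tendsto_summatory_tau_comp (m : ℕ) {X : ℝ → ℝ} {ξ a : ℝ} (ha : 0 < a)
    (hX : Tendsto X atTop atTop) (hξ : Tendsto (fun x => X x / x) atTop (𝓝 ξ))
    (hl : Tendsto (fun x => Real.log (X x) / Real.log x) atTop (𝓝 1)) :
    Tendsto (fun x => summatory (tau (m + 1)) (X x / a) / (x * Real.log x ^ m)) atTop
      (𝓝 (ξ / a * (m.factorial : ℝ)⁻¹)) := by
  have hY : Tendsto (fun x => X x / a) atTop atTop := hX.atTop_div_const ha
  have h1 := (tendsto_summatory_tau m).comp hY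
  have h2 := (tendsto_log_div_const ha hX hl).pow m
  have h3 := (hξ.div_const a).mul (h1.mul h2)
  rw [one_pow, mul_one] at h3
  refine h3.congr' ?_
  filter_upwards [hY.eventually_gt_atTop 1, eventually_gt_atTop 1] with x hx hx1
  have e1 : 0 < Real.log (X x / a) := Real.log_pos hx
  have e2 : 0 < Real.log x := Real.log_pos hx1
  have e3 : 0 < X x / a := by linarith
  have e4 : X x / x / a = (X x / a) / x := by ring
  simp only [Function.comp]
  rw [e4, div_pow]
  generalize X x / a = Y at *
  field_simp

lemma tendsto_summatory_divId_tau_comp (j : ℕ) {Q : ℝ → ℝ} {B b : ℝ} (hb : 0 < b)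
    (hQ : Tendsto Q atTop atTop)
    (hl : Tendsto (fun x => Real.log (Q x) / Real.log x) atTop (𝓝 B)) :
    Tendsto (fun x => summatory (divId (tau j)) (Q x / b) / Real.log x ^ j) atTop
      (𝓝 ((j.factorial : ℝ)⁻¹ * B ^ j)) := by
  have hY : Tendsto (fun x => Q x / b) atTop atTop := hQ.atTop_div_const hb
  have h3 := ((tendsto_summatory_divId_tau j).comp hY).mul ((tendsto_log_div_const hb hQ hl).pow j)
  refine h3.congr' ?_
  filter_upwards [hY.eventually_gt_atTop 1, eventually_gt_atTop 1] with x hx hx1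
  have e1 : 0 < Real.log (Q x / b) := Real.log_pos hx
  have e2 : 0 < Real.log x := Real.log_pos hx1
  simp only [Function.comp]
  rw [div_pow]
  field_simp

lemma summatory_tau_div_le (m : ℕ) {X : ℝ} (hX : 1 ≤ X) {a : ℕ} (ha : a ≠ 0) :
    summatory (tau (m + 1)) (X / a) ≤ X / a * (1 + Real.log X) ^ m := by
  have ha1 : (1 : ℝ) ≤ a := by exact_mod_cast Nat.pos_of_ne_zero ha
  have hlog := Real.log_nonneg hX
  rcases lt_or_ge (X / a) 1 with h | h
  · rw [summatory_of_lt_one _ h]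
    positivity
  · refine (summatory_tau_le m h).trans ?_
    have h1 : Real.log (X / a) ≤ Real.log X :=
      Real.log_le_log (by linarith) (div_le_self (by linarith) ha1)
    have h2 := Real.log_nonneg h
    gcongr

lemma summatory_divId_tau_div_le (j : ℕ) {Q : ℝ} (hQ : 1 ≤ Q) {b : ℕ} (hb : b ≠ 0) :
    summatory (divId (tau j)) (Q / b) ≤ (1 + Real.log Q) ^ j := by
  have hb1 : (1 : ℝ) ≤ b := by exact_mod_cast Nat.pos_of_ne_zero hb
  have hlog := Real.log_nonneg hQ
  rcases lt_or_ge (Q / b) 1 with h | h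
  · rw [summatory_of_lt_one _ h]
    positivity
  · refine (summatory_divId_tau_le j h).trans ?_
    have h1 : Real.log (Q / b) ≤ Real.log Q :=
      Real.log_le_log (by linarith) (div_le_self (by linarith) hb1)
    have h2 := Real.log_nonneg h
    gcongr

lemma tendsto_one_add_log_div {Y : ℝ → ℝ} {c : ℝ}
    (hl : Tendsto (fun x => Real.log (Y x) / Real.log x) atTop (𝓝 c)) :
    Tendsto (fun x => (1 + Real.log (Y x)) / Real.log x) atTop (𝓝 c) := by
  have hinv : Tendsto (fun y : ℝ => 1 / Real.log y) atTop (𝓝 0) :=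
    tendsto_const_nhds.div_atTop Real.tendsto_log_atTop
  have h := hinv.add hl
  rw [zero_add] at h
  exact h.congr fun x => (add_div _ _ _).symm

/-- Dominated convergence over the pairs `(a, b)`: replacing `X` by `X/a` divides the main term by
`a`, while replacing `Q` by `Q/b` changes only a logarithm and is invisible in the limit. -/
theorem tendsto_sumGcdWeight {h : ℕ} (hh : h ≠ 0) (m j : ℕ) {X Q : ℝ → ℝ} {ξ B : ℝ}
    (hX : Tendsto X atTop atTop) (hQ : Tendsto Q atTop atTop)
    (hξ : Tendsto (fun x => X x / x) atTop (𝓝 ξ))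
    (hlX : Tendsto (fun x => Real.log (X x) / Real.log x) atTop (𝓝 1))
    (hlQ : Tendsto (fun x => Real.log (Q x) / Real.log x) atTop (𝓝 B)) :
    Tendsto (fun x => sumGcdWeight h (m + 1) j (X x) (Q x) / (x * Real.log x ^ (m + j))) atTop
      (𝓝 ((∑' z : ℕ × ℕ, gcdKernel h (m + 1) j z.1 z.2 / z.1) *
        (ξ * (m.factorial : ℝ)⁻¹ * ((j.factorial : ℝ)⁻¹ * B ^ j)))) := by
  have hsum := summable_abs_gcdKernel_div hh (m + 1) (j + 1)
  rw [Nat.add_sub_cancel] at hsum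
  set G := gcdKernel h (m + 1) j with hG
  let f : ℝ → ℕ × ℕ → ℝ := fun x z => G z.1 z.2 *
    (summatory (tau (m + 1)) (X x / z.1) / (x * Real.log x ^ m) *
      (summatory (divId (tau j)) (Q x / z.2) / Real.log x ^ j))
  have hf : ∀ x, sumGcdWeight h (m + 1) j (X x) (Q x) / (x * Real.log x ^ (m + j)) =
      ∑' z, f x z := by
    intro x
    rw [sumGcdWeight_eq_tsum, ← tsum_div_const]
    refine tsum_congr fun z => ?_
    simp only [f]
    rw [div_mul_div_comm, ← mul_div_assoc, pow_add, ← mul_assoc x (Real.log x ^ m)]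
  simp_rw [hf]
  rw [← tsum_mul_right]
  -- The upper bounds for the summatory functions depend on `(a, b)` only through `1/a`; `U` is the
  -- remaining factor. It converges, so it is eventually at most its limit plus `1`, which is `C`.
  let U : ℝ → ℝ := fun x => X x / x * ((1 + Real.log (X x)) / Real.log x) ^ m *
    ((1 + Real.log (Q x)) / Real.log x) ^ j
  have hU : Tendsto U atTop (𝓝 (ξ * 1 ^ m * B ^ j)) :=
    (hξ.mul ((tendsto_one_add_log_div hlX).pow m)).mul ((tendsto_one_add_log_div hlQ).pow j)
  set C := ξ * 1 ^ m * B ^ j + 1 with hC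
  refine tendsto_tsum_of_dominated_convergence (hsum.mul_right C) (fun z => ?_) ?_
  · by_cases hz : z.1 * z.2 = 0
    · have h0 : G z.1 z.2 = 0 := by
        rcases Nat.mul_eq_zero.1 hz with h1 | h1
        · rw [h1]; exact gcdKernel_zero_left _ _ _ _
        · rw [h1]; exact gcdKernel_zero_right _ _ _ _
      simp only [f, h0, zero_mul, zero_div]
      exact tendsto_const_nhds
    · have h1 : (0 : ℝ) < z.1 := by exact_mod_cast Nat.pos_of_ne_zero (left_ne_zero_of_mul hz)
      have h2 : (0 : ℝ) < z.2 := by exact_mod_cast Nat.pos_of_ne_zero (right_ne_zero_of_mul hz)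
      have := ((tendsto_summatory_tau_comp m h1 hX hξ hlX).mul
        (tendsto_summatory_divId_tau_comp j h2 hQ hlQ)).const_mul (G z.1 z.2)
      refine this.trans_eq ?_
      congr 1
      ring
  · filter_upwards [hU.eventually_le_const (lt_add_one _), hX.eventually_ge_atTop 1,
      hQ.eventually_ge_atTop 1, eventually_gt_atTop 1] with x hUx hXx hQx hx z
    by_cases hz : z.1 * z.2 = 0
    · have h0 : G z.1 z.2 = 0 := by
        rcases Nat.mul_eq_zero.1 hz with h1 | h1
        · rw [h1]; exact gcdKernel_zero_left _ _ _ _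
        · rw [h1]; exact gcdKernel_zero_right _ _ _ _
      simp [f, h0]
    · have hlog : 0 < Real.log x := Real.log_pos hx
      have hx0 : 0 < x := by linarith
      have b1 := summatory_tau_div_le m hXx (left_ne_zero_of_mul hz)
      have b2 := summatory_divId_tau_div_le j hQx (right_ne_zero_of_mul hz)
      have n1 := summatory_nonneg (tau_nonneg (m + 1)) (X x / z.1)
      have n2 := summatory_nonneg (divId_tau_nonneg j) (Q x / z.2)
      have hlX0 := Real.log_nonneg hXx
      rw [Real.norm_eq_abs, abs_mul, abs_of_nonneg (a := _ * _) (by positivity)]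
      calc |G z.1 z.2| * (summatory (tau (m + 1)) (X x / z.1) / (x * Real.log x ^ m) *
            (summatory (divId (tau j)) (Q x / z.2) / Real.log x ^ j))
          ≤ |G z.1 z.2| * (X x / z.1 * (1 + Real.log (X x)) ^ m / (x * Real.log x ^ m) *
            ((1 + Real.log (Q x)) ^ j / Real.log x ^ j)) := by gcongr
        _ = |G z.1 z.2| / z.1 * U x := by
            simp only [U, div_pow]
            ring
        _ ≤ |G z.1 z.2| / z.1 * C := by gcongr

end

/-! ### Replacing progressions by their means -/

section

open ArithmeticFunction

/-- The `i`-th smallest element is at least `i + 1`, and `∏ (1 - 1/(i+1))` telescopes. -/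
lemma prod_one_sub_inv_ge (s : Finset ℕ) (hs : ∀ p ∈ s, 2 ≤ p) :
    ((s.card : ℝ) + 1)⁻¹ ≤ ∏ p ∈ s, (1 - (p : ℝ)⁻¹) := by
  induction s using Finset.induction_on_max with
  | empty => simp
  | insert a s hmax ih =>
    have ha : a ∉ s := fun h => lt_irrefl a (hmax a h)
    have hcard : s.card + 2 ≤ a := by
      have hsub : s ⊆ Finset.Ico 2 a := fun p hp =>
        Finset.mem_Ico.2 ⟨hs p (Finset.mem_insert_of_mem hp), hmax p hp⟩
      have h1 := Finset.card_le_card hsub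
      rw [Nat.card_Ico] at h1
      have h2 := hs a (Finset.mem_insert_self a s)
      lia
    have ih' := ih fun p hp => hs p (Finset.mem_insert_of_mem hp)
    rw [Finset.prod_insert ha, Finset.card_insert_of_notMem ha]
    have hc : ((s.card : ℝ) + 2) ≤ a := by exact_mod_cast hcard
    have h1 : (a : ℝ)⁻¹ ≤ ((s.card : ℝ) + 2)⁻¹ := inv_anti₀ (by positivity) hc
    have h2 : ((s.card + 1 : ℕ) : ℝ) + 1 = s.card + 2 := by push_cast; ring
    rw [h2]
    calc ((s.card : ℝ) + 2)⁻¹ = (1 - ((s.card : ℝ) + 2)⁻¹) * ((s.card : ℝ) + 1)⁻¹ := by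
          field_simp
          ring
      _ ≤ (1 - (a : ℝ)⁻¹) * ∏ p ∈ s, (1 - (p : ℝ)⁻¹) := by
          have : ((s.card : ℝ) + 2)⁻¹ ≤ 1 := inv_le_one_of_one_le₀ (by
            have : (0 : ℝ) ≤ s.card := by positivity
            linarith)
          gcongr
          linarith

/-- An integer `n` has at most `log n / log 2 ≤ 2 log n` prime factors. The loss of a logarithm is
harmless beside a power saving. -/
lemma inv_totient_le {n : ℕ} (hn : 1 ≤ n) :
    ((n.totient : ℝ))⁻¹ ≤ (1 + 2 * Real.log n) / n := by
  have hn0 : (0 : ℝ) < n := by exact_mod_cast hn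
  have h1 : (n.totient : ℝ) = n * ∏ p ∈ n.primeFactors, (1 - (p : ℝ)⁻¹) := by
    have := Nat.totient_eq_mul_prod_factors n
    have := congrArg (Rat.cast (K := ℝ)) this
    push_cast at this
    exact this
  have h2 := prod_one_sub_inv_ge n.primeFactors fun p hp => (Nat.prime_of_mem_primeFactors hp).two_le
  have h3 : (2 : ℕ) ^ n.primeFactors.card ≤ n := by
    calc 2 ^ n.primeFactors.card = ∏ _p ∈ n.primeFactors, 2 := by rw [Finset.prod_const]
      _ ≤ ∏ p ∈ n.primeFactors, p :=
        Finset.prod_le_prod' fun p hp => (Nat.prime_of_mem_primeFactors hp).two_le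
      _ ≤ n := Nat.le_of_dvd hn (Nat.prod_primeFactors_dvd n)
  have h4 : (n.primeFactors.card : ℝ) ≤ 2 * Real.log n := by
    have h5 : (2 : ℝ) ^ n.primeFactors.card ≤ n := by exact_mod_cast h3
    have h6 := Real.log_le_log (by positivity) h5
    rw [Real.log_pow] at h6
    have h7 := Real.log_two_gt_d9
    have h8 : (0 : ℝ) ≤ n.primeFactors.card := by positivity
    nlinarith
  rw [h1, mul_inv, div_eq_inv_mul]
  gcongr
  calc (∏ p ∈ n.primeFactors, (1 - (p : ℝ)⁻¹))⁻¹ ≤ ((((n.primeFactors.card : ℝ) + 1)⁻¹))⁻¹ :=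
        inv_anti₀ (by positivity) h2
    _ ≤ _ := by rw [inv_inv]; linarith

/-- The sum of `d_k(n + h)` over `n ≤ x`, weighted with the sum of `d_j(q)` over the divisors
`q ≤ Q` of `n`. -/
noncomputable def truncatedSum (h k j : ℕ) (x Q : ℝ) : ℝ :=
  ∑ n ∈ Finset.Icc 1 ⌊x⌋₊, tau k (n + h) * ∑ q ∈ n.divisors with ((q : ℕ) : ℝ) ≤ Q, tau j q

lemma truncatedSum_eq (h k j : ℕ) (x : ℝ) {Q : ℝ} (hQ : 0 ≤ Q) :
    truncatedSum h k j x Q = ∑ q ∈ Finset.Ioc 0 ⌊Q⌋₊,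
      tau j q * ∑ n ∈ Finset.Icc 1 ⌊x⌋₊ with q ∣ n, tau k (n + h) := by
  have h1 : ∀ n ∈ Finset.Icc 1 ⌊x⌋₊, (n.divisors.filter fun q : ℕ => (q : ℝ) ≤ Q) =
      (Finset.Ioc 0 ⌊Q⌋₊).filter fun q => q ∣ n := by
    intro n hn
    ext q
    have hn0 : n ≠ 0 := by rw [Finset.mem_Icc] at hn; lia
    simp only [Finset.mem_filter, Nat.mem_divisors, Finset.mem_Ioc, Nat.le_floor_iff hQ]
    exact ⟨fun H => ⟨⟨Nat.pos_of_dvd_of_pos H.1.1 (Nat.pos_of_ne_zero hn0), H.2⟩, H.1.1⟩,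
      fun H => ⟨⟨H.2, hn0⟩, H.1.2⟩⟩
  rw [truncatedSum, Finset.sum_congr rfl fun n hn => by rw [h1 n hn]]
  simp_rw [Finset.sum_filter, Finset.mul_sum]
  rw [Finset.sum_comm]
  refine Finset.sum_congr rfl fun q _ => Finset.sum_congr rfl fun n _ => ?_
  split_ifs <;> ring

/-- The shift by `h` turns `q ∣ n` into the class of `h`, on `h < m ≤ x + h`; the initial segment `m
≤ h` is subtracted. -/
lemma sum_dvd_tau_add (h k q : ℕ) {x : ℝ} (hx : 0 ≤ x) :
    ∑ n ∈ Finset.Icc 1 ⌊x⌋₊ with q ∣ n, tau k (n + h) =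
      divisorSumAP k q h (x + h) - ∑ m ∈ Finset.Icc 1 h with m ≡ h [MOD q], tau k m := by
  have hiff : ∀ n, n + h ≡ h [MOD q] ↔ q ∣ n := by
    intro n
    rw [← Nat.modEq_zero_iff_dvd]
    refine ⟨fun H => Nat.ModEq.add_right_cancel' h (by rwa [zero_add]), fun H => ?_⟩
    have := H.add_right h
    rwa [zero_add] at this
  simp_rw [divisorSumAP, Nat.floor_add_natCast hx, ← tau_apply, Finset.sum_filter, ← hiff]
  rw [← Finset.Ico_add_one_right_eq_Icc, ← Finset.Ico_add_one_right_eq_Icc,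
    ← Finset.Ico_add_one_right_eq_Icc,
    Finset.sum_Ico_add' (fun m => if m ≡ h [MOD q] then tau k m else 0) 1 (⌊x⌋₊ + 1) h,
    eq_sub_iff_add_eq, add_comm (Finset.sum _ _), add_comm 1 h, add_right_comm ⌊x⌋₊ 1 h]
  exact Finset.sum_Ico_consecutive _ (by lia) (by lia)

lemma sum_gcd_eq_tau (k : ℕ) {g q : ℕ} (hg : 0 < g) (hgq : g ∣ q) (X : ℝ) :
    ∑ m ∈ Finset.Icc 1 ⌊X / g⌋₊ with Nat.Coprime m (q / g), (divisorK k (g * m) : ℝ) =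
      ∑ n ∈ Finset.Ioc 0 ⌊X⌋₊ with n.gcd q = g, tau k n := by
  obtain ⟨r, rfl⟩ := hgq
  rw [Nat.mul_div_cancel_left r hg, Nat.floor_div_natCast]
  refine Finset.sum_nbij' (fun m => g * m) (fun n => n / g) ?_ ?_ ?_ ?_ ?_
  · intro m hm
    rw [Finset.mem_filter, Finset.mem_Icc] at hm
    rw [Finset.mem_filter, Finset.mem_Ioc, Nat.gcd_mul_left, hm.2.gcd_eq_one, mul_one]
    refine ⟨⟨Nat.mul_pos hg hm.1.1, ?_⟩, rfl⟩
    rw [mul_comm]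
    exact (Nat.le_div_iff_mul_le hg).1 hm.1.2
  · intro n hn
    rw [Finset.mem_filter, Finset.mem_Ioc] at hn
    obtain ⟨m, rfl⟩ : g ∣ n := hn.2 ▸ n.gcd_dvd_left _
    rw [Nat.mul_div_cancel_left m hg, Finset.mem_filter, Finset.mem_Icc]
    refine ⟨⟨Nat.pos_of_mul_pos_left hn.1.1, (Nat.le_div_iff_mul_le hg).2 (by lia)⟩, ?_⟩
    have := hn.2
    rw [Nat.gcd_mul_left] at this
    exact Nat.eq_of_mul_eq_mul_left hg (by rw [this, mul_one])
  · intro m _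
    exact Nat.mul_div_cancel_left m hg
  · intro n hn
    rw [Finset.mem_filter] at hn
    exact Nat.mul_div_cancel' (hn.2 ▸ n.gcd_dvd_left _)
  · intro m _
    rw [tau_apply]

lemma tau_mul_divisorMeanAP (h k j : ℕ) {q : ℕ} (hq : 0 < q) (X : ℝ) :
    tau j q * divisorMeanAP (h.gcd q) k q X =
      ∑ n ∈ Finset.Ioc 0 ⌊X⌋₊, gcdWeight h k j n q := by
  rw [divisorMeanAP, sum_gcd_eq_tau k (Nat.gcd_pos_of_pos_right h hq) (h.gcd_dvd_right q),
    Finset.sum_filter, Finset.mul_sum, Finset.mul_sum]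
  refine Finset.sum_congr rfl fun n _ => ?_
  rw [gcdWeight]
  split_ifs <;> ring

/-- The zero class, excluded from the hypothesis on `θ`, is the only class with `gcd = q`, so the
mean is exact. -/
lemma divisorSumAP_eq_divisorMeanAP (k : ℕ) {h q : ℕ} (hq : 0 < q) (hd : h ≡ 0 [MOD q]) (X : ℝ) :
    divisorSumAP k q h X = divisorMeanAP (h.gcd q) k q X := by
  have hqh : q ∣ h := (Nat.modEq_zero_iff_dvd).1 hd
  rw [divisorMeanAP, sum_gcd_eq_tau k (Nat.gcd_pos_of_pos_right h hq) (h.gcd_dvd_right q),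
    Nat.gcd_eq_right hqh, Nat.div_self hq, Nat.totient_one, Nat.cast_one, inv_one, one_mul,
    divisorSumAP]
  refine Finset.sum_congr ?_ fun n _ => (tau_apply k n).symm
  ext n
  simp only [Finset.mem_filter, Finset.mem_Icc, Finset.mem_Ioc, Nat.gcd_eq_right_iff_dvd,
    ← Nat.modEq_zero_iff_dvd]
  exact ⟨fun H => ⟨H.1, H.2.trans hd⟩, fun H => ⟨H.1, H.2.trans hd.symm⟩⟩

/-- The exponent and the constant depend on `g = (h, q)`, but `g` runs over the finitely many
divisors of `h`: take the least `δ` and the sum of the `|M|`. -/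
lemma exists_uniform_error {h k : ℕ} (hh : h ≠ 0) {θ : ℝ}
    (hθ : ∀ g : ℕ, 1 ≤ g → IsExponentOfDistribution g k θ) {ε : ℝ} (hε : 0 < ε) :
    ∃ δ : ℝ, 0 < δ ∧ ∃ M : ℝ, 0 ≤ M ∧ ∀ x : ℝ, 1 ≤ x → ∀ q : ℕ, 1 ≤ q → (q : ℝ) ≤ x ^ (θ - ε) →
      |divisorSumAP k q h x - divisorMeanAP (h.gcd q) k q x| ≤
        M * (x ^ (1 - δ) / ((q / h.gcd q).totient : ℝ)) := by
  have H : ∀ g : ℕ, ∃ δ : ℝ, 0 < δ ∧ (1 ≤ g → ∃ M : ℝ, ∀ x : ℝ, 1 ≤ x → ∀ q : ℕ, 1 ≤ q →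
      (q : ℝ) ≤ x ^ (θ - ε) → ∀ a : ℕ, Nat.gcd a q = g → ¬ a ≡ 0 [MOD q] →
        |divisorSumAP k q a x - divisorMeanAP g k q x| ≤
          M * (x ^ (1 - δ) / ((q / g).totient : ℝ))) := by
    intro g
    by_cases hg : 1 ≤ g
    · obtain ⟨δ, hδ, hM⟩ := (hθ g hg).2.2 ε hε
      exact ⟨δ, hδ, fun _ => hM⟩
    · exact ⟨1, one_pos, fun h => absurd h hg⟩
  choose δ hδ H using H
  choose! M hM using H
  obtain ⟨g₀, hg₀, hmin⟩ := Finset.exists_min_image h.divisors δ ⟨1, Nat.one_mem_divisors.2 hh⟩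
  refine ⟨δ g₀, hδ g₀, ∑ g ∈ h.divisors, |M g|, Finset.sum_nonneg fun _ _ => abs_nonneg _, ?_⟩
  intro x hx q hq hqx
  have hx0 : 0 < x := by linarith
  by_cases hd : h ≡ 0 [MOD q]
  · rw [divisorSumAP_eq_divisorMeanAP k hq hd, sub_self, abs_zero]
    exact mul_nonneg (Finset.sum_nonneg fun _ _ => abs_nonneg _) (by positivity)
  · have hg : h.gcd q ∈ h.divisors := Nat.mem_divisors.2 ⟨h.gcd_dvd_left q, hh⟩
    refine (hM _ (Nat.gcd_pos_of_pos_right h hq) x hx q hq hqx h rfl hd).trans ?_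
    have h1 : M (h.gcd q) ≤ ∑ g ∈ h.divisors, |M g| :=
      (le_abs_self _).trans
        (Finset.single_le_sum (f := fun g => |M g|) (fun _ _ => abs_nonneg _) hg)
    have h2 : x ^ (1 - δ (h.gcd q)) ≤ x ^ (1 - δ g₀) :=
      Real.rpow_le_rpow_of_exponent_le hx (by linarith [hmin _ hg])
    calc _ ≤ (∑ g ∈ h.divisors, |M g|) * (x ^ (1 - δ (h.gcd q)) / ((q / h.gcd q).totient : ℝ)) :=
          mul_le_mul_of_nonneg_right h1 (by positivity)
      _ ≤ _ := by
          have := Finset.sum_nonneg fun (g : ℕ) (_ : g ∈ h.divisors) => abs_nonneg (M g)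
          gcongr

lemma exists_abs_truncatedSum_sub_le {h k : ℕ} (hh : h ≠ 0) (j : ℕ) {θ : ℝ}
    (hθ : ∀ g : ℕ, 1 ≤ g → IsExponentOfDistribution g k θ) {B : ℝ} (hB : 0 < B) (hBθ : B < θ) :
    ∃ δ : ℝ, 0 < δ ∧ ∃ M : ℝ, 0 ≤ M ∧ ∀ x : ℝ, 1 ≤ x → ∀ Q : ℝ, 1 ≤ Q → Q ≤ x ^ B →
      |truncatedSum h k j x Q - sumGcdWeight h k j (x + h) Q| ≤
        M * (x ^ (1 - δ) * (1 + Real.log x) ^ (j + 1)) := by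
  obtain ⟨δ₀, hδ₀, M, hM, herr⟩ := exists_uniform_error hh hθ (sub_pos.2 hBθ)
  have hθ1 : θ ≤ 1 := (hθ 1 le_rfl).2.1
  set c : ℝ := ∑ m ∈ Finset.Icc 1 h, tau k m with hc
  have hc0 : 0 ≤ c := Finset.sum_nonneg fun m _ => tau_nonneg k m
  -- The initial segments `m ≤ h` cost at most `c` for each `q`, in total `Q c ∑ τ_j(q)/q` with `Q ≤
  -- x^B`; hence `δ ≤ 1 - B`. In the constant below, `1 + h` comes from `x + h ≤ (1 + h) x`, and
  -- `2h` from `1/φ(q/g) ≤ h (1 + 2 log x)/q`.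
  set δ := min δ₀ (1 - B) with hδ
  have hδB : B ≤ 1 - δ := by linarith [min_le_right δ₀ (1 - B)]
  refine ⟨δ, lt_min hδ₀ (by linarith), M * ((1 + h) * (2 * h)) + c, by positivity, ?_⟩
  intro x hx Q hQ1 hQx
  have hx0 : 0 < x := by linarith
  have hlx : 0 ≤ Real.log x := Real.log_nonneg hx
  have hh1 : (1 : ℝ) ≤ h := by exact_mod_cast Nat.pos_of_ne_zero hh
  have hxB : x ^ B ≤ x := by
    calc x ^ B ≤ x ^ (1 : ℝ) := Real.rpow_le_rpow_of_exponent_le hx (by linarith)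
      _ = x := Real.rpow_one x
  have hlQ : Real.log Q ≤ Real.log x := Real.log_le_log (by linarith) (hQx.trans hxB)
  have hlQ0 : 0 ≤ Real.log Q := Real.log_nonneg hQ1
  have hX : (x + h) ^ (1 - δ₀) ≤ (1 + h) * x ^ (1 - δ) := by
    calc (x + h) ^ (1 - δ₀) ≤ (x + h) ^ (1 - δ) :=
          Real.rpow_le_rpow_of_exponent_le (by linarith) (by linarith [min_le_left δ₀ (1 - B)])
      _ ≤ ((1 + h) * x) ^ (1 - δ) :=
          Real.rpow_le_rpow (by linarith) (by nlinarith) (by linarith)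
      _ = (1 + h : ℝ) ^ (1 - δ) * x ^ (1 - δ) := Real.mul_rpow (by linarith) hx0.le
      _ ≤ (1 + h : ℝ) ^ (1 : ℝ) * x ^ (1 - δ) := by
          gcongr
          · linarith
          · have := lt_min hδ₀ (by linarith : 0 < 1 - B)
            linarith
      _ = _ := by rw [Real.rpow_one]
  set Y := x ^ (1 - δ) with hY
  have hY0 : 0 < Y := by positivity
  have hswap : sumGcdWeight h k j (x + h) Q = ∑ q ∈ Finset.Ioc 0 ⌊Q⌋₊,
      tau j q * divisorMeanAP (h.gcd q) k q (x + h) := by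
    rw [sumGcdWeight, Finset.sum_comm]
    exact Finset.sum_congr rfl fun q hq =>
      (tau_mul_divisorMeanAP h k j (mem_Ioc_floor hq).1 (x + h)).symm
  rw [truncatedSum_eq h k j x (by linarith), hswap, ← Finset.sum_sub_distrib]
  refine (Finset.abs_sum_le_sum_abs _ _).trans ?_
  have hterm : ∀ q ∈ Finset.Ioc 0 ⌊Q⌋₊,
      |tau j q * ∑ n ∈ Finset.Icc 1 ⌊x⌋₊ with q ∣ n, tau k (n + h) -
        tau j q * divisorMeanAP (h.gcd q) k q (x + h)| ≤
      (M * ((1 + h) * Y) * (h * (1 + 2 * Real.log x)) + Q * c) * divId (tau j) q := by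
    intro q hq
    obtain ⟨hq0, hqQ⟩ := mem_Ioc_floor hq
    have hq0' : (0 : ℝ) < q := by exact_mod_cast hq0
    have h1 : (q : ℝ) ≤ (x + h) ^ (θ - (θ - B)) := by
      rw [sub_sub_cancel]
      exact hqQ.trans (hQx.trans (Real.rpow_le_rpow hx0.le (by linarith) hB.le))
    have h2 := herr (x + h) (by linarith) q hq0 h1
    have hgpos : 0 < h.gcd q := Nat.gcd_pos_of_pos_right h hq0
    have h3 : (((q / h.gcd q).totient : ℝ))⁻¹ ≤ h * (1 + 2 * Real.log x) / q := by
      have hr : 1 ≤ q / h.gcd q := Nat.div_pos (Nat.le_of_dvd hq0 (h.gcd_dvd_right q)) hgpos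
      have hgh : ((h.gcd q : ℕ) : ℝ) ≤ h := by
        exact_mod_cast Nat.le_of_dvd (Nat.pos_of_ne_zero hh) (h.gcd_dvd_left q)
      have hg0 : (0 : ℝ) < (h.gcd q : ℕ) := by exact_mod_cast hgpos
      have hr' : (((q / h.gcd q : ℕ)) : ℝ) = q / (h.gcd q : ℕ) :=
        Nat.cast_div (h.gcd_dvd_right q) hg0.ne'
      have hl : Real.log (q / h.gcd q : ℕ) ≤ Real.log x := by
        refine Real.log_le_log (by exact_mod_cast hr) ?_
        calc ((q / h.gcd q : ℕ) : ℝ) ≤ q := by exact_mod_cast Nat.div_le_self _ _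
          _ ≤ x := hqQ.trans (hQx.trans hxB)
      calc _ ≤ (1 + 2 * Real.log (q / h.gcd q : ℕ)) / (q / h.gcd q : ℕ) := inv_totient_le hr
        _ ≤ (1 + 2 * Real.log x) / (q / h.gcd q : ℕ) := by gcongr
        _ = (h.gcd q : ℕ) * (1 + 2 * Real.log x) / q := by
            rw [hr']
            field_simp
        _ ≤ _ := by gcongr
    have h4 : |∑ m ∈ Finset.Icc 1 h with m ≡ h [MOD q], tau k m| ≤ c := by
      rw [abs_of_nonneg (Finset.sum_nonneg fun m _ => tau_nonneg k m)]
      exact Finset.sum_le_sum_of_subset_of_nonneg (Finset.filter_subset _ _)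
        fun m _ _ => tau_nonneg k m
    have hτ := tau_nonneg j q
    rw [sum_dvd_tau_add h k q hx0.le, ← mul_sub, abs_mul, abs_of_nonneg hτ, sub_right_comm]
    calc tau j q * |divisorSumAP k q h (x + h) - divisorMeanAP (h.gcd q) k q (x + h) -
          ∑ m ∈ Finset.Icc 1 h with m ≡ h [MOD q], tau k m|
        ≤ tau j q * (M * ((x + h) ^ (1 - δ₀) / ((q / h.gcd q).totient : ℝ)) + c) := by
          gcongr
          exact (abs_sub _ _).trans (add_le_add h2 h4)
      _ ≤ tau j q * (M * ((1 + h) * Y * (h * (1 + 2 * Real.log x) / q)) + Q / q * c) := by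
          rw [div_eq_mul_inv]
          have : 1 ≤ Q / q := (one_le_div hq0').2 hqQ
          gcongr
          exact le_mul_of_one_le_left hc0 this
      _ = _ := by
          rw [divId_apply]
          field_simp
  refine (Finset.sum_le_sum hterm).trans ?_
  rw [← Finset.mul_sum]
  have hE := summatory_divId_tau_le j hQ1
  rw [summatory] at hE
  have hE' : ∑ q ∈ Finset.Ioc 0 ⌊Q⌋₊, divId (tau j) q ≤ (1 + Real.log x) ^ j :=
    hE.trans (by gcongr)
  have hQY : Q ≤ Y := hQx.trans (Real.rpow_le_rpow_of_exponent_le hx hδB)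
  calc (M * ((1 + h) * Y) * (h * (1 + 2 * Real.log x)) + Q * c) *
        ∑ q ∈ Finset.Ioc 0 ⌊Q⌋₊, divId (tau j) q
      ≤ (M * ((1 + h) * Y) * (h * (2 * (1 + Real.log x))) + Y * c * (1 + Real.log x)) *
        (1 + Real.log x) ^ j := by
        have hs : 0 ≤ ∑ q ∈ Finset.Ioc 0 ⌊Q⌋₊, divId (tau j) q :=
          Finset.sum_nonneg fun q _ => divId_tau_nonneg j q
        have hQc : Q * c ≤ Y * c * (1 + Real.log x) :=
          calc Q * c ≤ Y * c := by gcongr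
            _ ≤ Y * c * (1 + Real.log x) := le_mul_of_one_le_right (by positivity) (by linarith)
        refine mul_le_mul (add_le_add ?_ hQc) hE' hs (by positivity)
        gcongr
        linarith
    _ = _ := by ring

end

/-! ### Fixed and moving cutoffs -/

lemma tendsto_rpow_mul_log_pow_div {δ : ℝ} (hδ : 0 < δ) (n : ℕ) :
    Tendsto (fun y : ℝ => y ^ (1 - δ) * (1 + Real.log y) ^ n / y) atTop (𝓝 0) := by
  have h1 : Tendsto (fun y : ℝ => Real.log y ^ (n : ℝ) / y ^ δ) atTop (𝓝 0) :=
    (isLittleO_log_rpow_rpow_atTop (n : ℝ) hδ).tendsto_div_nhds_zero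
  have h2 : Tendsto (fun y : ℝ => ((1 + Real.log y) / Real.log y) ^ n) atTop (𝓝 (1 ^ n)) := by
    refine (tendsto_one_add_log_div ?_).pow n
    refine tendsto_const_nhds.congr' ?_
    filter_upwards [eventually_gt_atTop 1] with y hy
    rw [div_self (Real.log_pos hy).ne']
  have h3 := h2.mul h1
  rw [mul_zero] at h3
  refine h3.congr' ?_
  filter_upwards [eventually_gt_atTop 1] with y hy
  have hl := Real.log_pos hy
  have hy0 : 0 < y := by linarith
  rw [Real.rpow_natCast, Real.rpow_sub hy0, Real.rpow_one, div_pow]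
  field_simp

lemma tendsto_log_const_mul_div {ξ : ℝ} (hξ : 0 < ξ) :
    Tendsto (fun x : ℝ => Real.log (ξ * x) / Real.log x) atTop (𝓝 1) := by
  have h1 : Tendsto (fun x : ℝ => Real.log x / Real.log x) atTop (𝓝 1) := by
    refine tendsto_const_nhds.congr' ?_
    filter_upwards [eventually_gt_atTop 1] with y hy
    rw [div_self (Real.log_pos hy).ne']
  refine (tendsto_log_div_const (inv_pos.2 hξ) tendsto_id h1).congr fun x => ?_
  rw [id, div_inv_eq_mul, mul_comm]

/-- Two scales are needed because the lower bound for the moving cutoff compares the sums up to `x`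
and up to `ηx` with the same cutoff `(ηx)^B`. -/
lemma tendsto_truncatedSum {h : ℕ} (hh : h ≠ 0) (m j : ℕ) {θ : ℝ}
    (hθ : ∀ g : ℕ, 1 ≤ g → IsExponentOfDistribution g (m + 1) θ) {B : ℝ} (hB : 0 < B) (hBθ : B < θ)
    {ξ η : ℝ} (hη : 0 < η) (hηξ : η ≤ ξ) :
    Tendsto (fun x => truncatedSum h (m + 1) j (ξ * x) ((η * x) ^ B) /
      (x * Real.log x ^ (m + j))) atTop
      (𝓝 (ξ * (constC (m + 1) (j + 1) * factorF (m + 1) (j + 1) h /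
        ((m.factorial : ℝ) * (j.factorial : ℝ)) * B ^ j))) := by
  have hξ : 0 < ξ := hη.trans_le hηξ
  have hξx : Tendsto (fun x : ℝ => ξ * x) atTop atTop := tendsto_id.const_mul_atTop hξ
  have hηx : Tendsto (fun x : ℝ => η * x) atTop atTop := tendsto_id.const_mul_atTop hη
  have hX : Tendsto (fun x : ℝ => ξ * x + h) atTop atTop := tendsto_atTop_add_const_right _ _ hξx
  have hQ : Tendsto (fun x : ℝ => (η * x) ^ B) atTop atTop := (tendsto_rpow_atTop hB).comp hηx
  have hXx : Tendsto (fun x : ℝ => (ξ * x + h) / x) atTop (𝓝 ξ) := by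
    have h1 : Tendsto (fun x : ℝ => ξ + h / x) atTop (𝓝 (ξ + 0)) :=
      tendsto_const_nhds.add (tendsto_const_nhds.div_atTop tendsto_id)
    rw [add_zero] at h1
    refine h1.congr' ?_
    filter_upwards [eventually_gt_atTop 0] with x hx
    field_simp
  have hlX : Tendsto (fun x : ℝ => Real.log (ξ * x + h) / Real.log x) atTop (𝓝 1) := by
    have h1 := (hXx.log hξ.ne').div_atTop Real.tendsto_log_atTop
    have h2 := h1.const_add 1
    rw [add_zero] at h2
    refine h2.congr' ?_
    filter_upwards [eventually_gt_atTop 1] with x hx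
    have hl := Real.log_pos hx
    have hx0 : 0 < x := by linarith
    rw [Real.log_div (by positivity) hx0.ne']
    field_simp
    ring
  have hlQ : Tendsto (fun x : ℝ => Real.log ((η * x) ^ B) / Real.log x) atTop (𝓝 B) := by
    have h1 := (tendsto_log_const_mul_div hη).const_mul B
    rw [mul_one] at h1
    refine h1.congr' ?_
    filter_upwards [eventually_gt_atTop 0] with x hx
    rw [Real.log_rpow (by positivity), mul_div_assoc]
  have hmain := tendsto_sumGcdWeight hh m j hX hQ hXx hlX hlQ
  have hval := tsum_gcdKernel_div hh (Nat.le_add_left 1 m) (Nat.le_add_left 1 j)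
  rw [Nat.add_sub_cancel] at hval
  rw [hval] at hmain
  obtain ⟨δ, hδ, M, hM, herr⟩ := exists_abs_truncatedSum_sub_le hh j hθ hB hBθ
  have hsmall : Tendsto (fun x : ℝ => (truncatedSum h (m + 1) j (ξ * x) ((η * x) ^ B) -
      sumGcdWeight h (m + 1) j (ξ * x + h) ((η * x) ^ B)) / (x * Real.log x ^ (m + j)))
      atTop (𝓝 0) := by
    have h1 := (((tendsto_rpow_mul_log_pow_div hδ (j + 1)).comp hξx).const_mul (M * ξ))
    rw [mul_zero] at h1
    refine squeeze_zero_norm' ?_ h1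
    filter_upwards [hξx.eventually_ge_atTop 1, hηx.eventually_ge_atTop 1,
      Real.tendsto_log_atTop.eventually_ge_atTop 1, eventually_gt_atTop 0] with x h1 h2 h3 h4
    have h5 := herr (ξ * x) h1 ((η * x) ^ B) (Real.one_le_rpow h2 hB.le)
      (Real.rpow_le_rpow (by linarith) (by gcongr) hB.le)
    have h6 : 1 ≤ Real.log x ^ (m + j) := one_le_pow₀ h3
    have h7 := Real.log_nonneg h1
    rw [Real.norm_eq_abs, abs_div, abs_of_pos (a := x * _) (by positivity)]
    calc _ ≤ M * ((ξ * x) ^ (1 - δ) * (1 + Real.log (ξ * x)) ^ (j + 1)) /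
          (x * Real.log x ^ (m + j)) := by gcongr
      _ ≤ M * ((ξ * x) ^ (1 - δ) * (1 + Real.log (ξ * x)) ^ (j + 1)) / x := by
          gcongr
          exact le_mul_of_one_le_right h4.le h6
      _ = _ := by
          simp only [Function.comp]
          field_simp
  have hadd := hsmall.add hmain
  rw [zero_add] at hadd
  refine (hadd.congr fun x => ?_).trans_eq ?_
  · rw [← add_div, sub_add_cancel]
  · congr 1
    field_simp

/-- The sum of `d_k(n + h) d_l(n, B)` over `n ≤ x`. -/
noncomputable def partialSum (h k l : ℕ) (B x : ℝ) : ℝ :=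
  ∑ n ∈ Finset.Icc 1 ⌊x⌋₊, (divisorK k (n + h) : ℝ) * (partialDivisorK l n B : ℝ)

lemma partialDivisorK_succ_cast (j n : ℕ) (B : ℝ) :
    (partialDivisorK (j + 1) n B : ℝ) =
      ∑ q ∈ n.divisors with ((q : ℕ) : ℝ) ≤ (n : ℝ) ^ B, tau j q := by
  rw [partialDivisorK, Nat.add_sub_cancel]
  push_cast
  exact Finset.sum_congr rfl fun q _ => (tau_apply j q).symm

lemma sum_filter_tau_mono (j n : ℕ) {Q Q' : ℝ} (h : Q ≤ Q') :
    ∑ q ∈ n.divisors with ((q : ℕ) : ℝ) ≤ Q, tau j q ≤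
      ∑ q ∈ n.divisors with ((q : ℕ) : ℝ) ≤ Q', tau j q :=
  Finset.sum_le_sum_of_subset_of_nonneg
    (Finset.monotone_filter_right _ fun _ _ hq => le_trans hq h) fun q _ _ => tau_nonneg j q

lemma partialSum_le_truncatedSum (h k j : ℕ) {B x : ℝ} (hB : 0 ≤ B) (hx : 0 ≤ x) :
    partialSum h k (j + 1) B x ≤ truncatedSum h k j x (x ^ B) := by
  refine Finset.sum_le_sum fun n hn => ?_
  rw [← tau_apply, partialDivisorK_succ_cast]
  have hnx : (n : ℝ) ≤ x := (Nat.le_floor_iff hx).1 (Finset.mem_Icc.1 hn).2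
  exact mul_le_mul_of_nonneg_left
    (sum_filter_tau_mono j n (Real.rpow_le_rpow n.cast_nonneg hnx hB)) (tau_nonneg _ _)

/-- For `y < n ≤ x` the cutoff `n^B` is at least `y^B`; the nonnegative terms with `n ≤ y` are
dropped. -/
lemma truncatedSum_sub_le_partialSum (h k j : ℕ) {B x y : ℝ} (hB : 0 ≤ B) (hy : 0 ≤ y)
    (hyx : y ≤ x) :
    truncatedSum h k j x (y ^ B) - truncatedSum h k j y (y ^ B) ≤ partialSum h k (j + 1) B x := by
  have hsub : Finset.Icc 1 ⌊y⌋₊ ⊆ Finset.Icc 1 ⌊x⌋₊ :=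
    Finset.Icc_subset_Icc_right (Nat.floor_le_floor hyx)
  rw [truncatedSum, truncatedSum, partialSum, sub_le_iff_le_add, ← Finset.sum_sdiff hsub]
  refine add_le_add (le_trans ?_ (Finset.sum_le_sum_of_subset_of_nonneg
    (Finset.sdiff_subset (t := Finset.Icc 1 ⌊y⌋₊)) fun n _ _ => by positivity)) le_rfl
  refine Finset.sum_le_sum fun n hn => ?_
  rw [← tau_apply, partialDivisorK_succ_cast]
  have hny : y ≤ n := by
    rw [Finset.mem_sdiff, Finset.mem_Icc, Finset.mem_Icc, not_and, not_le] at hn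
    exact (Nat.lt_of_floor_lt (hn.2 hn.1.1)).le
  exact mul_le_mul_of_nonneg_left
    (sum_filter_tau_mono j n (Real.rpow_le_rpow hy hny hB)) (tau_nonneg _ _)

theorem tendsto_partialSum {h : ℕ} (hh : h ≠ 0) (m j : ℕ) {θ : ℝ}
    (hθ : ∀ g : ℕ, 1 ≤ g → IsExponentOfDistribution g (m + 1) θ) {B : ℝ} (hB : 0 < B)
    (hBθ : B < θ) :
    Tendsto (fun x => partialSum h (m + 1) (j + 1) B x / (x * Real.log x ^ (m + j))) atTop
      (𝓝 (constC (m + 1) (j + 1) * factorF (m + 1) (j + 1) h /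
        ((m.factorial : ℝ) * (j.factorial : ℝ)) * B ^ j)) := by
  set c := constC (m + 1) (j + 1) * factorF (m + 1) (j + 1) h /
    ((m.factorial : ℝ) * (j.factorial : ℝ)) * B ^ j
  have hT := fun {ξ η : ℝ} => tendsto_truncatedSum (ξ := ξ) (η := η) hh m j hθ hB hBθ
  refine tendsto_order.2 ⟨fun a ha => ?_, fun a ha => ?_⟩
  -- With `y = ηx` the lower bound has the limit `c - ηc`, which exceeds `a < c` once `η` is small.
  -- The sign of `c` plays no role.
  · have hlim : Tendsto (fun η : ℝ => 1 * c - η * c) (𝓝[>] 0) (𝓝 c) := by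
      have h1 : Tendsto (fun η : ℝ => 1 * c - η * c) (𝓝 0) (𝓝 (1 * c - 0 * c)) :=
        (continuous_const.sub (continuous_id.mul continuous_const)).tendsto 0
      rw [zero_mul, one_mul, sub_zero] at h1
      simpa using h1.mono_left nhdsWithin_le_nhds
    have hev := (hlim.eventually_const_lt ha).and
      ((eventually_mem_nhdsWithin (a := (0 : ℝ)) (s := Set.Ioi 0)).and
        (nhdsWithin_le_nhds (eventually_lt_nhds (zero_lt_one (α := ℝ)))))
    obtain ⟨η, h1, h2, h3⟩ := hev.exists
    rw [Set.mem_Ioi] at h2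
    have h4 := (hT h2 h3.le).sub (hT h2 le_rfl)
    filter_upwards [h4.eventually_const_lt h1, eventually_gt_atTop 1] with x hx hx1
    refine hx.trans_le ?_
    have hl := Real.log_pos hx1
    have hx0 : 0 < x := by linarith
    rw [← sub_div, one_mul]
    gcongr
    exact truncatedSum_sub_le_partialSum h (m + 1) j hB.le (by positivity) (by nlinarith)
  · have h1 := hT one_pos le_rfl
    rw [one_mul] at h1
    filter_upwards [h1.eventually_lt_const ha, eventually_gt_atTop 1] with x hx hx1
    refine lt_of_le_of_lt ?_ hx
    have hl := Real.log_pos hx1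
    have hx0 : 0 < x := by linarith
    rw [one_mul]
    gcongr
    exact partialSum_le_truncatedSum h (m + 1) j hB.le hx0.le

/-! ### The equivalence -/

lemma additiveDivisorAsymptotic_iff_partialDivisorApproximation {h k l : ℕ} (hh : 1 ≤ h)
    (hk : 1 ≤ k) (hl : 1 ≤ l) {θ : ℝ} (hθ : ∀ g : ℕ, 1 ≤ g → IsExponentOfDistribution g k θ)
    {B : ℝ} (hB : 0 < B) (hBθ : B < θ) :
    AdditiveDivisorAsymptotic h k l ↔ PartialDivisorApproximation h k l B := by
  have hh0 : h ≠ 0 := by lia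
  obtain ⟨m, rfl⟩ := Nat.exists_eq_add_of_le' hk
  obtain ⟨j, rfl⟩ := Nat.exists_eq_add_of_le' hl
  have hK : m + 1 + (j + 1) - 2 = m + j := by lia
  have hT := tendsto_partialSum hh0 m j hθ hB hBθ
  rw [AdditiveDivisorAsymptotic, PartialDivisorApproximation]
  simp only [hK, Nat.add_sub_cancel]
  -- Were the constant `0`, the relation `~` would force the sum to vanish eventually; only for a
  -- nonzero constant is it the same as an error `o(x log^(m+j) x)`.
  have hc0 : constC (m + 1) (j + 1) * factorF (m + 1) (j + 1) h /
      ((m.factorial : ℝ) * (j.factorial : ℝ)) ≠ 0 :=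
    div_ne_zero (mul_ne_zero (constC_ne_zero hk hl) (factorF_pos hh0 hk).ne')
      (mul_ne_zero (by exact_mod_cast m.factorial_ne_zero) (by exact_mod_cast j.factorial_ne_zero))
  set c := constC (m + 1) (j + 1) * factorF (m + 1) (j + 1) h /
    ((m.factorial : ℝ) * (j.factorial : ℝ))
  have hBj : B ^ (1 - ((j + 1 : ℕ) : ℤ)) = (B ^ j)⁻¹ := by
    rw [zpow_one_sub_natCast_eq hl, Nat.add_sub_cancel]
  have hmain : (fun x : ℝ => (B ^ j)⁻¹ * partialSum h (m + 1) (j + 1) B x -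
      c * (x * Real.log x ^ (m + j))) =o[atTop] fun x : ℝ => x * Real.log x ^ (m + j) := by
    rw [isLittleO_iff_tendsto']
    · have h1 := (hT.const_mul (B ^ j)⁻¹).sub_const c
      have e : (B ^ j)⁻¹ * (c * B ^ j) - c = 0 := by
        have := (pow_pos hB j).ne'
        field_simp
        ring
      rw [e] at h1
      refine h1.congr' ?_
      filter_upwards [eventually_gt_atTop 1] with x hx
      have hl := Real.log_pos hx
      have hx0 : 0 < x := by linarith
      field_simp
    · filter_upwards [eventually_gt_atTop 1] with x hx h0
      have hl := Real.log_pos hx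
      have hx0 : 0 < x := by linarith
      exact absurd h0 (by positivity)
  -- The sum in statement 2 is `D(x)` minus the rescaled partial sum, which `hmain` identifies with
  -- the main term up to a negligible error.
  have hsplit : ∀ x : ℝ, ∑ n ∈ Finset.Icc 1 ⌊x⌋₊, (divisorK (m + 1) (n + h) : ℝ) *
      ((divisorK (j + 1) n : ℝ) - B ^ (1 - ((j + 1 : ℕ) : ℤ)) * (partialDivisorK (j + 1) n B : ℝ)) =
      additiveDivisorSum h (m + 1) (j + 1) x - (B ^ j)⁻¹ * partialSum h (m + 1) (j + 1) B x := by
    intro x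
    rw [hBj, additiveDivisorSum, partialSum, Finset.mul_sum, ← Finset.sum_sub_distrib]
    exact Finset.sum_congr rfl fun n _ => by ring
  simp_rw [hsplit]
  rw [IsEquivalent, isLittleO_const_mul_right_iff hc0]
  constructor
  · intro H
    exact (H.sub hmain).congr_left fun x => by simp only [Pi.sub_apply]; ring
  · intro H
    exact (H.add hmain).congr_left fun x => by simp only [Pi.sub_apply]; ring

theorem mainTheorem5 (h k l : ℕ) (hh : 1 ≤ h) (hk : 1 ≤ k) (hl : 1 ≤ l) (θ : ℝ)
    (hθ : ∀ g : ℕ, 1 ≤ g → IsExponentOfDistribution g k θ) :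
    (AdditiveDivisorAsymptotic h k l ↔
      ∃ B : ℝ, 0 < B ∧ B < θ ∧ PartialDivisorApproximation h k l B) ∧
    (AdditiveDivisorAsymptotic h k l ↔
      ∀ B : ℝ, 0 < B → B < θ → PartialDivisorApproximation h k l B) := by
  have hiff := fun {B : ℝ} (hB : 0 < B) (hBθ : B < θ) =>
    additiveDivisorAsymptotic_iff_partialDivisorApproximation hh hk hl hθ hB hBθ
  have hθ0 : 0 < θ := (hθ 1 le_rfl).1
  -- Any point of `(0, θ)` would do; one is needed so that statement 3 is not vacuous.
  have h0 : 0 < θ / 2 := by linarith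
  have h1 : θ / 2 < θ := by linarith
  refine ⟨⟨fun H => ⟨θ / 2, h0, h1, (hiff h0 h1).1 H⟩, ?_⟩,
    ⟨fun H B hB hBθ => (hiff hB hBθ).1 H, fun H => (hiff h0 h1).2 (H _ h0 h1)⟩⟩
  rintro ⟨B, hB, hBθ, H⟩
  exact (hiff hB hBθ).2 H
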